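/- Let $d\ge 1$ and let $\Omega\subset\mathbb R^d$ be a bounded domain (nonempty, open, connected) with Lipschitz boundary. Let $\mathbf C\in L^\infty(\Omega;\mathbb R^{d\times d})$ be symmetric and uniformly elliptic, i.e. there is $c_0>0$ with $\xi^\top\mathbf C(x)\xi\ge c_0|\xi|^2$ for a.e. $x\in\Omega$ and all $\xi\in\mathbb R^d$. Let $\mathbf a\in L^\infty(\Omega)$ and $\mathbf q\in L^\infty(\operatorname{bd}\Omega)$ be nonnegative almost everywhere with $\|\mathbf a\|_{L^\infty(\Omega)}+\|\mathbf q\|_{L^\infty(\operatorname{bd}\Omega)}>0$, let $\Omega_u,\Omega_v$ be Lebesgue measurable sets of positive measure with $\Omega_u\cup\Omega_v=\Omega$, and let $y_{\mathrm d}\in L^2(\Omega)$ and $\alpha_1,\alpha_2>0$. Put $$\widetilde{\mathbb C}:=\{(u,v)\in L^2(\Omega)^2 : u(x)\ge 0,\ v(x)\ge 0,\ u(x)v(x)=0\ \text{for a.e. } x\in\Omega\}.$$ Call $(y,u,v)\in H^1(\Omega)\times L^2(\Omega)\times L^2(\Omega)$ feasible if $(u,v)\in\widetilde{\mathbb C}$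 and $y$ is a weak solution of $-\nabla\cdot(\mathbf C\nabla y)+\mathbf a y=\chi_{\Omega_u}u+\chi_{\Omega_v}v$ in $\Omega$ with the Robin condition $\vec{\mathbf n}\cdot(\mathbf C\nabla y)+\mathbf q y=0$ on $\operatorname{bd}\Omega$, that is, for all $w\in H^1(\Omega)$, $$\int_\Omega (\mathbf C\nabla y)\cdot\nabla w+\mathbf a\,y\,w\,\mathrm dx+\int_{\operatorname{bd}\Omega}\mathbf q\,y\,w\,\mathrm d\sigma=\int_\Omega(\chi_{\Omega_u}u+\chi_{\Omega_v}v)\,w\,\mathrm dx,$$ where $\sigma$ is the surface measure and $y,w$ in the boundary integral are traces. Then the problem of minimizing $$\tfrac12\|y-y_{\mathrm d}\|_{L^2(\Omega)}^2+\tfrac{\alpha_1}{2}\|u\|_{L^2(\Omega)}^2+\tfrac{\alpha_2}{2}\|v\|_{L^2(\Omega)}^2$$ over all feasible $(y,u,v)$ has an optimal solution (a feasible triple at which the minimum is attained). Nevertheless, the set $\widetilde{\mathbb C}$ is not weakly sequentially closed in $L^2(\Omega)^2$. -/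

import Mathlib

open MeasureTheory Filter Topology
open scoped ContDiff NNReal ENNReal Matrix

noncomputable section

namespace RobinControl

/-- Euclidean space `ℝ^d`. -/
abbrev E (d : ℕ) : Type := EuclideanSpace ℝ (Fin d)

/-- The `i`-th standard unit vector of `ℝ^d`. -/
abbrev unitVec {d : ℕ} (i : Fin d) : E d := EuclideanSpace.single i (1 : ℝ)

/-- `Ω` has a Lipschitz boundary: near each boundary point, after a rotation, `Ω` is the set of
points strictly above the graph of a Lipschitz function. The direction "upwards" is the unit
vector `e`, and the Lipschitz function is defined on the hyperplane orthogonal to `e`. -/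
def HasLipschitzBoundary {d : ℕ} (Ω : Set (E d)) : Prop :=
  ∀ x₀ ∈ frontier Ω, ∃ e : E d, ‖e‖ = 1 ∧
    ∃ (K : ℝ≥0) (γ : (ℝ ∙ e)ᗮ → ℝ), LipschitzWith K γ ∧
      ∃ U : Set (E d), IsOpen U ∧ x₀ ∈ U ∧
        ∀ x ∈ U, x ∈ Ω ↔ γ ((ℝ ∙ e)ᗮ.orthogonalProjectionOnto x) < inner ℝ e x

/-- A bounded Lipschitz domain: a nonempty, connected, bounded open set with Lipschitz boundary. -/
structure IsBoundedLipschitzDomain {d : ℕ} (Ω : Set (E d)) : Prop where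
  isOpen : IsOpen Ω
  isConnected : IsConnected Ω
  isBounded : Bornology.IsBounded Ω
  lipschitz : HasLipschitzBoundary Ω

/-- The surface measure on the boundary of `Ω`: the `(d-1)`-dimensional Hausdorff measure,
normalized so as to agree with Lebesgue measure on `ℝ^(d-1)`, restricted to the boundary. -/
def surfaceMeasure {d : ℕ} (Ω : Set (E d)) : Measure (E d) :=
  (Measure.euclideanHausdorffMeasure (d - 1)).restrict (frontier Ω)

/-- `L²(Ω)`. -/
abbrev L2 {d : ℕ} (Ω : Set (E d)) : Type := Lp ℝ 2 (volume.restrict Ω)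

/-- `L²(bd Ω)`. -/
abbrev L2Boundary {d : ℕ} (Ω : Set (E d)) : Type := Lp ℝ 2 (surfaceMeasure Ω)

/-- `g` is the weak partial derivative of `f` in direction `i` on `Ω`: integration by parts holds
against all smooth functions with compact support in `Ω`. -/
def IsWeakPartialDeriv {d : ℕ} (Ω : Set (E d)) (i : Fin d) (f g : L2 Ω) : Prop :=
  ∀ ψ : E d → ℝ, ContDiff ℝ ∞ ψ → HasCompactSupport ψ → tsupport ψ ⊆ Ω →
    ∫ x in Ω, f x * fderiv ℝ ψ x (unitVec i) = -∫ x in Ω, g x * ψ x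

/-- The Sobolev space `H¹(Ω)`: functions in `L²(Ω)` together with their weak partial derivatives,
which lie in `L²(Ω)`. -/
structure H1 {d : ℕ} (Ω : Set (E d)) where
  /-- The function, as an element of `L²(Ω)` (the embedding of `H¹(Ω)` into `L²(Ω)`). -/
  fn : L2 Ω
  /-- The weak partial derivatives. -/
  grad : Fin d → L2 Ω
  isWeakPartialDeriv : ∀ i, IsWeakPartialDeriv Ω i fn (grad i)

/-- The functions `φ k`, smooth on `ℝ^d`, restricted to `Ω`, converge to `y` in `H¹(Ω)`. -/
def SmoothTendstoH1 {d : ℕ} {Ω : Set (E d)} (φ : ℕ → E d → ℝ) (y : H1 Ω) : Prop :=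
  Tendsto (fun k => eLpNorm (fun x => φ k x - y.fn x) 2 (volume.restrict Ω)) atTop (𝓝 0) ∧
    ∀ i, Tendsto (fun k => eLpNorm (fun x => fderiv ℝ (φ k) x (unitVec i) - y.grad i x) 2
      (volume.restrict Ω)) atTop (𝓝 0)

/-- `g ∈ L²(bd Ω)` is the trace of `y ∈ H¹(Ω)`, i.e. `g` is the value at `y` of the continuous
extension to `H¹(Ω)` of the map that restricts functions smooth up to the boundary to `bd Ω`:
some such functions converge to `y` in `H¹(Ω)` while their boundary values converge to `g` in
`L²(bd Ω)`. -/
def IsTrace {d : ℕ} {Ω : Set (E d)} (y : H1 Ω) (g : L2Boundary Ω) : Prop :=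
  ∃ φ : ℕ → E d → ℝ, (∀ k, ContDiff ℝ ∞ (φ k)) ∧ SmoothTendstoH1 φ y ∧
    Tendsto (fun k => eLpNorm (fun x => φ k x - g x) 2 (surfaceMeasure Ω)) atTop (𝓝 0)

/-- `y ∈ H¹(Ω)` is a weak solution of `-∇·(C ∇y) + a y = f` in `Ω`, `n·(C ∇y) + q y = 0` on
`bd Ω`: for all `w ∈ H¹(Ω)`,
`∫_Ω (C ∇y)·∇w + a y w dx + ∫_{bd Ω} q y w dσ = ∫_Ω f w dx`. In the boundary integral, `y` and `w`
stand for their traces `g` and `h`. -/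
def IsWeakSolution {d : ℕ} {Ω : Set (E d)} (C : E d → Matrix (Fin d) (Fin d) ℝ)
    (a q f : E d → ℝ) (y : H1 Ω) : Prop :=
  ∃ g : L2Boundary Ω, IsTrace y g ∧
    ∀ (w : H1 Ω) (h : L2Boundary Ω), IsTrace w h →
      (∫ x in Ω, ((C x *ᵥ fun j => y.grad j x) ⬝ᵥ (fun i => w.grad i x)
          + a x * y.fn x * w.fn x))
        + ∫ x, q x * g x * h x ∂(surfaceMeasure Ω)
      = ∫ x in Ω, f x * w.fn x

/-- The complementarity set in `L²(Ω)²`: pairs with `0 ≤ u(x) ⊥ v(x) ≥ 0` for a.e. `x ∈ Ω`. -/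
def complementaritySet {d : ℕ} (Ω : Set (E d)) : Set (L2 Ω × L2 Ω) :=
  {p | ∀ᵐ x ∂(volume.restrict Ω), 0 ≤ p.1 x ∧ 0 ≤ p.2 x ∧ p.1 x * p.2 x = 0}

/-- The feasible set of the control problem: triples `(y, u, v)` of a state and two controls,
such that the controls are complementary and `y` is a weak solution of the Robin problem with
right-hand side `χ_{Ωu} u + χ_{Ωv} v`. -/
def feasibleSet {d : ℕ} (Ω : Set (E d)) (C : E d → Matrix (Fin d) (Fin d) ℝ) (a q : E d → ℝ)
    (Ωu Ωv : Set (E d)) : Set (H1 Ω × L2 Ω × L2 Ω) :=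
  {p | IsWeakSolution C a q
      (fun x => Ωu.indicator (fun x => p.2.1 x) x + Ωv.indicator (fun x => p.2.2 x) x) p.1 ∧
    (p.2.1, p.2.2) ∈ complementaritySet Ω}

/-- The objective `½‖y - y_d‖² + (α₁/2)‖u‖² + (α₂/2)‖v‖²` with norms of `L²(Ω)`. -/
def objective {d : ℕ} {Ω : Set (E d)} (yd : L2 Ω) (α₁ α₂ : ℝ) (p : H1 Ω × L2 Ω × L2 Ω) : ℝ :=
  1 / 2 * ‖p.1.fn - yd‖ ^ 2 + α₁ / 2 * ‖p.2.1‖ ^ 2 + α₂ / 2 * ‖p.2.2‖ ^ 2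

end RobinControl

end

open MeasureTheory Filter Topology
open scoped ContDiff NNReal ENNReal Matrix

namespace RobinControl

variable {d : ℕ}

/-! The complementarity constraint does not survive weak limits, so the direct method fails on a
general minimizing sequence. But the state sees only χ_{Ωu}u + χ_{Ωv}v, and this allows the supports
of the controls to be fixed in advance. Let α₁ ≤ α₂, as symmetry permits. Given feasible (u, v),
shift the effective part of v on Ωu to the cheaper control: u' = χ_{Ωu}(u + χ_{Ωv}v), v' = v off Ωu
and 0 on Ωu. The right-hand side, hence the state, is unchanged, and as uv = 0 gives (u + v)² = u² +
v², the cost does not grow (`exists_nonnegSupportedOn_of_complementary`). Nonnegative controls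
supported in Ωu and in its complement are automatically complementary and form a closed convex set.

After scaling by √α₁ and √α₂ the objective is half the squared distance in L²(Ω)³ to (y_d, 0, 0), so
a minimizer is a nearest point of a closed convex set, nonempty because it contains zero. What
remains is that pairs (state, right-hand side) form a closed subspace of L²(Ω)²
(`isClosed_solutionSpace`): ellipticity controls gradients of differences by the L² data, and the
trace inequality `exists_norm_trace_le` then makes the traces converge. That inequality comes from
the fundamental theorem of calculus along segments entering Ω from its boundary graph, Fubini, and
compactness of the boundary.

Weak closedness fails because (1 ± rₙ)/2, with square waves rₙ of growing frequency, are
complementary pairs tending weakly to (1/2, 1/2) (`tendsto_integral_mul_wave`). -/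

/-! ### The trace inequality for smooth functions -/

/-- One-dimensional trace estimate. -/
theorem mul_sq_le_lintegral {f f' : ℝ → ℝ} (hf : ∀ t, HasDerivAt f (f' t) t)
    (hf' : Continuous f') {s : ℝ} (hs : 0 < s) :
    ENNReal.ofReal (s * f 0 ^ 2) ≤
      ∫⁻ t in Set.Ioc 0 s, ENNReal.ofReal ((1 + s) * (f t ^ 2 + f' t ^ 2)) := by
  have hfc : Continuous f := continuous_iff_continuousAt.2 fun t => (hf t).continuousAt
  -- The weight t - s vanishes at t = s, so only the boundary value at 0 survives.
  have hFTC : ∫ t in (0 : ℝ)..s, (f t ^ 2 + (t - s) * (2 * f t * f' t)) = s * f 0 ^ 2 := by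
    rw [intervalIntegral.integral_eq_sub_of_hasDerivAt (f := fun t => (t - s) * f t ^ 2)]
    · ring
    · intro t _
      have h := ((hasDerivAt_id t).sub_const s).mul ((hf t).pow 2)
      refine h.congr_deriv ?_
      simp
    · exact Continuous.intervalIntegrable (by fun_prop) _ _
  have hint : IntegrableOn (fun t => (1 + s) * (f t ^ 2 + f' t ^ 2)) (Set.Ioc 0 s) := by
    have : Continuous (fun t => (1 + s) * (f t ^ 2 + f' t ^ 2)) := by fun_prop
    exact this.integrableOn_Ioc
  rw [← ofReal_integral_eq_lintegral_ofReal hint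
    (Eventually.of_forall fun t => by simp only [Pi.zero_apply]; positivity),
    ← intervalIntegral.integral_of_le hs.le, ← hFTC]
  refine ENNReal.ofReal_le_ofReal (intervalIntegral.integral_mono_on hs.le
    (Continuous.intervalIntegrable (by fun_prop) _ _)
    (Continuous.intervalIntegrable (by fun_prop) _ _) fun t ht => ?_)
  have h1 : 0 ≤ t := ht.1
  have h2 : t ≤ s := ht.2
  -- Young's inequality for the cross term: -2(s - t)ff' ≤ (s - t)(f² + f'²).
  nlinarith [mul_nonneg (sub_nonneg.2 h2) (sq_nonneg (f t + f' t)),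
    mul_nonneg h1 (sq_nonneg (f t)), mul_nonneg h1 (sq_nonneg (f' t)), sq_nonneg (f' t)]

/-- The splitting of `ℝ^d` into the hyperplane orthogonal to a unit vector and its span. -/
theorem exists_hyperplane_splitting {e : E d} (he : ‖e‖ = 1) :
    ∃ L : ((ℝ ∙ e)ᗮ × ℝ) ≃L[ℝ] E d, (∀ z t, L (z, t) = z + t • e) ∧
      ∀ x, L.symm x = ((ℝ ∙ e)ᗮ.orthogonalProjectionOnto x, inner ℝ e x) := by
  let f₁ : ((ℝ ∙ e)ᗮ × ℝ) →L[ℝ] E d :=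
    (ℝ ∙ e)ᗮ.subtypeL.comp (ContinuousLinearMap.fst ℝ _ ℝ) +
      (ContinuousLinearMap.snd ℝ (ℝ ∙ e)ᗮ ℝ).smulRight e
  let f₂ : E d →L[ℝ] ((ℝ ∙ e)ᗮ × ℝ) :=
    ((ℝ ∙ e)ᗮ.orthogonalProjectionOnto).prod (innerSL ℝ e)
  have hleft : Function.LeftInverse f₂ f₁ := by
    rintro ⟨z, t⟩
    have hz : inner ℝ e (z : E d) = 0 := Submodule.mem_orthogonal_singleton_iff_inner_right.1 z.2
    have hez : (ℝ ∙ e)ᗮ.orthogonalProjectionOnto e = 0 := by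
      rw [Submodule.orthogonalProjectionOnto_eq_zero_iff]
      exact Submodule.le_orthogonal_orthogonal _ (Submodule.mem_span_singleton_self e)
    ext1
    · simp [f₁, f₂, hez]
    · simp [f₁, f₂, inner_add_right, inner_smul_right, hz, he]
  have hright : Function.RightInverse f₂ f₁ := by
    intro x
    have h := (ℝ ∙ e).starProjection_add_starProjection_orthogonal x
    rw [Submodule.starProjection_unit_singleton ℝ he, Submodule.starProjection_apply] at h
    simpa [f₁, f₂, add_comm] using h
  exact ⟨ContinuousLinearEquiv.equivOfInverse f₁ f₂ hleft hright, fun z t => by simp [f₁],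
    fun x => rfl⟩

/-- Fubini's theorem along a unit vector, up to a constant. -/
theorem exists_lintegral_hyperplane_splitting {e : E d} (L : ((ℝ ∙ e)ᗮ × ℝ) ≃L[ℝ] E d) :
    ∃ c : ℝ≥0, ∀ F : E d → ℝ≥0∞, Measurable F →
      ∫⁻ z, ∫⁻ t, F (L (z, t)) = c * ∫⁻ x, F x := by
  have := L.isAddHaarMeasure_map ((volume : Measure (ℝ ∙ e)ᗮ).prod (volume : Measure ℝ))
  -- By uniqueness of Haar measure the pushed-forward product measure is a multiple of Lebesgue
  -- measure; the value of the factor is irrelevant.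
  refine ⟨Measure.addHaarScalarFactor
    (Measure.map L ((volume : Measure (ℝ ∙ e)ᗮ).prod (volume : Measure ℝ))) volume, ?_⟩
  intro F hF
  have hL : Measurable L := L.continuous.measurable
  rw [← lintegral_prod (fun p => F (L p)) (hF.comp hL).aemeasurable, ← lintegral_map hF hL]
  conv_lhs => rw [Measure.isAddLeftInvariant_eq_smul
    (Measure.map L ((volume : Measure (ℝ ∙ e)ᗮ).prod (volume : Measure ℝ))) volume]
  rw [lintegral_smul_measure]
  rfl

theorem finrank_orthogonal_span_singleton_of_norm_eq_one {e : E d} (he : ‖e‖ = 1) :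
    Module.finrank ℝ (ℝ ∙ e)ᗮ = d - 1 := by
  have h := (ℝ ∙ e).finrank_add_finrank_orthogonal
  rw [finrank_span_singleton (by rintro rfl; simp at he), finrank_euclideanSpace_fin] at h
  omega

/-- The surface measure of a Lipschitz image of a subset of a hyperplane is bounded by its area. -/
theorem euclideanHausdorffMeasure_image_le {e : E d} (he : ‖e‖ = 1) {G : (ℝ ∙ e)ᗮ → E d}
    {K : ℝ≥0} (hG : LipschitzWith K G) (A : Set (ℝ ∙ e)ᗮ) :
    Measure.euclideanHausdorffMeasure (d - 1) (G '' A) ≤ (K ^ (d - 1) : ℝ≥0) * volume A := by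
  -- Area on the hyperplane is itself a normalized (d-1)-dimensional Hausdorff measure, so the same
  -- normalizing factor stands on both sides.
  rw [← InnerProductSpace.euclideanHausdorffMeasure_eq_volume,
    finrank_orthogonal_span_singleton_of_norm_eq_one he,
    Measure.euclideanHausdorffMeasure_def, Measure.euclideanHausdorffMeasure_def,
    Measure.smul_apply, Measure.smul_apply, ENNReal.smul_def, ENNReal.smul_def, smul_eq_mul,
    smul_eq_mul, mul_left_comm]
  gcongr
  have h := hG.hausdorffMeasure_image_le (Nat.cast_nonneg (d - 1)) A
  simpa [ENNReal.rpow_natCast] using h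

/-- The bound for images of sets says that the surface measure on `G '' B` is dominated by K^(d-1)
times the pushforward of area on `B`; integrals inherit this. -/
theorem lintegral_image_le {e : E d} (he : ‖e‖ = 1) {G : (ℝ ∙ e)ᗮ → E d}
    {K : ℝ≥0} (hG : LipschitzWith K G) (B : Set (ℝ ∙ e)ᗮ)
    {F : E d → ℝ≥0∞} (hF : Measurable F) :
    ∫⁻ x in G '' B, F x ∂(Measure.euclideanHausdorffMeasure (d - 1)) ≤
      (K ^ (d - 1) : ℝ≥0) * ∫⁻ z in B, F (G z) := by
  have hGm : Measurable G := hG.continuous.measurable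
  rw [← lintegral_map hF hGm, ← smul_eq_mul, ← lintegral_smul_measure]
  refine lintegral_mono' (Measure.le_iff.2 fun S hS => ?_) le_rfl
  rw [Measure.restrict_apply hS, Set.inter_comm, ← Set.image_inter_preimage, Measure.smul_apply,
    smul_eq_mul, Measure.map_apply hGm hS, Measure.restrict_apply (hGm hS), Set.inter_comm]
  exact euclideanHausdorffMeasure_image_le he hG _

/-- The integrand of the squared `H¹` norm. -/
noncomputable def energyDensity (φ : E d → ℝ) (x : E d) : ℝ :=
  φ x ^ 2 + ∑ i, fderiv ℝ φ x (unitVec i) ^ 2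

theorem continuous_energyDensity {φ : E d → ℝ} (hφ : ContDiff ℝ ∞ φ) :
    Continuous (energyDensity φ) := by
  have h := hφ.continuous
  have h' : Continuous (fderiv ℝ φ) := hφ.continuous_fderiv (by simp)
  unfold energyDensity
  fun_prop

/-- Cauchy–Schwarz in coordinates: a derivative in a unit direction is bounded by the full gradient.
-/
theorem sq_apply_le_sum_sq (T : E d →L[ℝ] ℝ) {e : E d} (he : ‖e‖ = 1) :
    T e ^ 2 ≤ ∑ i, T (unitVec i) ^ 2 := by
  have h1 : T e = ∑ i, e i * T (unitVec i) := by
    have : e = ∑ i, e i • (unitVec i : E d) := by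
      have := (EuclideanSpace.basisFun (Fin d) ℝ).sum_repr e
      simpa using this.symm
    conv_lhs => rw [this]
    simp
  have h2 : ∑ i, e i ^ 2 = 1 := by
    have := EuclideanSpace.real_norm_sq_eq e
    rw [← this, he]; norm_num
  rw [h1]
  refine (Finset.sum_mul_sq_le_sq_mul_sq _ _ _).trans ?_
  rw [h2, one_mul]

theorem ofReal_mul_sq_le_lintegral_line {φ : E d → ℝ} (hφ : ContDiff ℝ ∞ φ) {e : E d}
    (he : ‖e‖ = 1) (x : E d) {s : ℝ} (hs : 0 < s) :
    ENNReal.ofReal (s * φ x ^ 2) ≤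
      ENNReal.ofReal (1 + s) * ∫⁻ t in Set.Ioc 0 s, ENNReal.ofReal (energyDensity φ (x + t • e)) := by
  have hd : ∀ t : ℝ, HasDerivAt (fun t : ℝ => φ (x + t • e)) (fderiv ℝ φ (x + t • e) e) t := by
    intro t
    have h1 : HasDerivAt (fun t : ℝ => x + t • e) e t := by
      simpa using ((hasDerivAt_id t).smul_const e).const_add x
    exact ((hφ.differentiable (by simp)) _).hasFDerivAt.comp_hasDerivAt t h1
  have hc : Continuous fun t : ℝ => fderiv ℝ φ (x + t • e) e := by
    have h' : Continuous (fderiv ℝ φ) := hφ.continuous_fderiv (by simp)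
    fun_prop
  have h := mul_sq_le_lintegral hd hc hs
  simp only [zero_smul, add_zero] at h
  refine h.trans ?_
  rw [← lintegral_const_mul' _ _ ENNReal.ofReal_ne_top]
  refine lintegral_mono fun t => ?_
  rw [← ENNReal.ofReal_mul (by positivity)]
  refine ENNReal.ofReal_le_ofReal (mul_le_mul_of_nonneg_left ?_ (by positivity))
  exact add_le_add le_rfl (sq_apply_le_sum_sq _ he)

/-- In a boundary chart, the boundary lies on the graph. -/
theorem inner_eq_of_mem_frontier {Ω U : Set (E d)} (hΩ : IsOpen Ω) (hU : IsOpen U) {e : E d}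
    {γ : (ℝ ∙ e)ᗮ → ℝ} (hγ : Continuous γ)
    (h : ∀ x ∈ U, x ∈ Ω ↔ γ ((ℝ ∙ e)ᗮ.orthogonalProjectionOnto x) < inner ℝ e x)
    {x : E d} (hxU : x ∈ U) (hx : x ∈ frontier Ω) :
    inner ℝ e x = γ ((ℝ ∙ e)ᗮ.orthogonalProjectionOnto x) := by
  rw [hΩ.frontier_eq] at hx
  refine le_antisymm (not_lt.1 fun hlt => hx.2 ((h x hxU).2 hlt)) (not_lt.1 fun hlt => ?_)
  have hopen : IsOpen (U ∩ {x | inner ℝ e x < γ ((ℝ ∙ e)ᗮ.orthogonalProjectionOnto x)}) :=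
    hU.inter (isOpen_lt (by fun_prop) (by fun_prop))
  obtain ⟨y, hy, hyΩ⟩ := mem_closure_iff.1 hx.1 _ hopen ⟨hxU, hlt⟩
  exact absurd ((h y hy.1).1 hyΩ) (not_lt.2 (le_of_lt hy.2))

/-- Near a boundary point, the boundary lies on a Lipschitz graph above which there is a layer of
uniform thickness contained in the domain. -/
theorem exists_layer_above_graph {Ω : Set (E d)} (hΩ : IsOpen Ω)
    (hL : HasLipschitzBoundary Ω) {x₀ : E d} (hx₀ : x₀ ∈ frontier Ω) :
    ∃ e : E d, ‖e‖ = 1 ∧ ∃ (K : ℝ≥0) (γ : (ℝ ∙ e)ᗮ → ℝ), LipschitzWith K γ ∧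
      ∃ V : Set (E d), IsOpen V ∧ x₀ ∈ V ∧ ∃ B : Set (ℝ ∙ e)ᗮ, MeasurableSet B ∧
        V ∩ frontier Ω ⊆ (fun z : (ℝ ∙ e)ᗮ => (z : E d) + γ z • e) '' B ∧
        ∃ s : ℝ, 0 < s ∧ ∀ z ∈ B, ∀ t ∈ Set.Ioc 0 s, (z : E d) + (γ z + t) • e ∈ Ω := by
  obtain ⟨e, he, K, γ, hγ, U, hU, hxU, hchart⟩ := hL x₀ hx₀
  obtain ⟨L, hLapp, hLsymm⟩ := exists_hyperplane_splitting he
  have hsymm : ∀ (z : (ℝ ∙ e)ᗮ) (t : ℝ), ((ℝ ∙ e)ᗮ.orthogonalProjectionOnto ((z : E d) + t • e),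
      inner ℝ e ((z : E d) + t • e)) = (z, t) := fun z t => by
    rw [← hLsymm, ← hLapp, L.symm_apply_apply]
  have hPL : ∀ (z : (ℝ ∙ e)ᗮ) (t : ℝ),
      (ℝ ∙ e)ᗮ.orthogonalProjectionOnto ((z : E d) + t • e) = z :=
    fun z t => congrArg Prod.fst (hsymm z t)
  have hIL : ∀ (z : (ℝ ∙ e)ᗮ) (t : ℝ), inner ℝ e ((z : E d) + t • e) = t :=
    fun z t => congrArg Prod.snd (hsymm z t)
  have hgraph : ∀ x ∈ U, x ∈ frontier Ω →
      ((ℝ ∙ e)ᗮ.orthogonalProjectionOnto x : E d) +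
        γ ((ℝ ∙ e)ᗮ.orthogonalProjectionOnto x) • e = x := fun x hxU hx => by
    rw [← inner_eq_of_mem_frontier hΩ hU hγ.continuous hchart hxU hx, ← hLapp, ← hLsymm,
      L.apply_symm_apply]
  have hcont : Continuous fun p : (ℝ ∙ e)ᗮ × ℝ => (p.1 : E d) + (γ p.1 + p.2) • e := by
    have := hγ.continuous
    fun_prop
  have hnhds : ∀ᶠ p : (ℝ ∙ e)ᗮ × ℝ in 𝓝 ((ℝ ∙ e)ᗮ.orthogonalProjectionOnto x₀, (0 : ℝ)),
      (p.1 : E d) + (γ p.1 + p.2) • e ∈ U := by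
    refine hcont.continuousAt.eventually_mem (hU.mem_nhds ?_)
    simpa only [add_zero, hgraph x₀ hxU hx₀] using hxU
  obtain ⟨r, hr, hball⟩ := Metric.eventually_nhds_iff.1 hnhds
  have hVopen : IsOpen {x | x ∈ U ∧ dist ((ℝ ∙ e)ᗮ.orthogonalProjectionOnto x)
      ((ℝ ∙ e)ᗮ.orthogonalProjectionOnto x₀) < r} :=
    hU.inter (isOpen_lt
      (((ℝ ∙ e)ᗮ.orthogonalProjectionOnto.continuous).dist continuous_const) continuous_const)
  have hVmem : x₀ ∈ {x | x ∈ U ∧ dist ((ℝ ∙ e)ᗮ.orthogonalProjectionOnto x)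
      ((ℝ ∙ e)ᗮ.orthogonalProjectionOnto x₀) < r} := ⟨hxU, by rwa [dist_self]⟩
  -- The thickness is r / 2 because the layer includes t = s while the ball of radius r (in the
  -- maximum metric) is open.
  refine ⟨e, he, K, γ, hγ, _, hVopen, hVmem,
    Metric.ball ((ℝ ∙ e)ᗮ.orthogonalProjectionOnto x₀) r, measurableSet_ball, ?_,
    r / 2, half_pos hr, ?_⟩
  · intro x hx
    exact ⟨_, hx.1.2, hgraph x hx.1.1 hx.2⟩
  · intro z hz t ht
    have hzU : (z : E d) + (γ z + t) • e ∈ U := by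
      refine hball (y := (z, t)) ?_
      rw [Prod.dist_eq, max_lt_iff]
      refine ⟨hz, ?_⟩
      simp only [dist_zero_right, Real.norm_eq_abs, abs_of_pos ht.1]
      exact lt_of_le_of_lt ht.2 (half_lt_self hr)
    rw [hchart _ hzU, hIL, hPL]
    linarith [ht.1]

/-- A boundary value is controlled by the energy along a segment in the domain. -/
theorem ofReal_sq_le_lintegral_indicator {Ω : Set (E d)} {φ : E d → ℝ} (hφ : ContDiff ℝ ∞ φ)
    {e : E d} (he : ‖e‖ = 1) (z : E d) (b : ℝ) {s : ℝ} (hs : 0 < s)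
    (hmem : ∀ t ∈ Set.Ioc 0 s, z + (b + t) • e ∈ Ω) :
    ENNReal.ofReal (φ (z + b • e) ^ 2) ≤ ENNReal.ofReal s⁻¹ * ENNReal.ofReal (1 + s) *
      ∫⁻ t : ℝ, Ω.indicator (fun x => ENNReal.ofReal (energyDensity φ x)) (z + t • e) := by
  have h1 := ofReal_mul_sq_le_lintegral_line hφ he (z + b • e) hs
  have h2 : ENNReal.ofReal (φ (z + b • e) ^ 2) =
      ENNReal.ofReal s⁻¹ * ENNReal.ofReal (s * φ (z + b • e) ^ 2) := by
    rw [← ENNReal.ofReal_mul (by positivity), ← mul_assoc, inv_mul_cancel₀ hs.ne', one_mul]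
  rw [h2, mul_assoc]
  refine mul_le_mul_right (h1.trans (mul_le_mul_right ?_ _)) _
  -- Extension by zero outside Ω allows integration over the whole line; translation invariance then
  -- removes the shift b, which will depend on the base point.
  calc ∫⁻ t in Set.Ioc 0 s, ENNReal.ofReal (energyDensity φ (z + b • e + t • e))
      = ∫⁻ t in Set.Ioc 0 s,
          Ω.indicator (fun x => ENNReal.ofReal (energyDensity φ x)) (z + (b + t) • e) := by
        refine setLIntegral_congr_fun measurableSet_Ioc fun t ht => ?_
        rw [Set.indicator_of_mem (hmem t ht), add_smul, add_assoc]
    _ ≤ ∫⁻ t, Ω.indicator (fun x => ENNReal.ofReal (energyDensity φ x)) (z + (b + t) • e) :=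
        setLIntegral_le_lintegral _ _
    _ = _ := lintegral_add_left_eq_self
        (fun t => Ω.indicator (fun x => ENNReal.ofReal (energyDensity φ x)) (z + t • e)) b

/-- The bound along segments is integrated over the base of the chart: Fubini turns the right side
into an integral over Ω, and the Lipschitz parametrization compares surface measure with area on the
base. -/
theorem exists_local_trace_inequality {Ω : Set (E d)} (hΩ : IsOpen Ω)
    (hL : HasLipschitzBoundary Ω) {x₀ : E d} (hx₀ : x₀ ∈ frontier Ω) :
    ∃ V : Set (E d), IsOpen V ∧ x₀ ∈ V ∧ ∃ M : ℝ≥0, ∀ φ : E d → ℝ, ContDiff ℝ ∞ φ →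
      ∫⁻ x in V, ENNReal.ofReal (φ x ^ 2) ∂(surfaceMeasure Ω) ≤
        M * ∫⁻ x in Ω, ENNReal.ofReal (energyDensity φ x) := by
  obtain ⟨e, he, K, γ, hγ, V, hV, hxV, B, hB, hsub, s, hs, hmem⟩ :=
    exists_layer_above_graph hΩ hL hx₀
  obtain ⟨L, hLapp, -⟩ := exists_hyperplane_splitting he
  obtain ⟨c, hc⟩ := exists_lintegral_hyperplane_splitting L
  obtain ⟨K', hK'⟩ : ∃ K' : ℝ≥0, LipschitzWith K' fun z : (ℝ ∙ e)ᗮ => (z : E d) + γ z • e := by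
    have h := L.toContinuousLinearMap.lipschitz.comp (LipschitzWith.id.prodMk hγ)
    have heq : (fun z : (ℝ ∙ e)ᗮ => (z : E d) + γ z • e) = L ∘ fun z => (id z, γ z) :=
      funext fun z => (hLapp z (γ z)).symm
    exact ⟨_, heq ▸ h⟩
  refine ⟨V, hV, hxV, K' ^ (d - 1) * (s⁻¹.toNNReal * (1 + s).toNNReal * c), fun φ hφ => ?_⟩
  have hmφ : Measurable fun x => ENNReal.ofReal (φ x ^ 2) :=
    ((hφ.continuous.pow 2).measurable).ennreal_ofReal
  have hmE : Measurable fun x => ENNReal.ofReal (energyDensity φ x) :=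
    (continuous_energyDensity hφ).measurable.ennreal_ofReal
  have hfub := hc _ (hmE.indicator hΩ.measurableSet)
  rw [lintegral_indicator hΩ.measurableSet] at hfub
  simp only [hLapp] at hfub
  have hstrip : ∫⁻ z in B, ENNReal.ofReal (φ ((z : E d) + γ z • e) ^ 2) ≤
      ENNReal.ofReal s⁻¹ * ENNReal.ofReal (1 + s) *
        (c * ∫⁻ x in Ω, ENNReal.ofReal (energyDensity φ x)) := by
    refine (setLIntegral_mono' hB fun z hz =>
      ofReal_sq_le_lintegral_indicator hφ he (z : E d) (γ z) hs (hmem z hz)).trans ?_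
    refine (setLIntegral_le_lintegral _ _).trans ?_
    rw [lintegral_const_mul' _ _ (ENNReal.mul_ne_top ENNReal.ofReal_ne_top
      ENNReal.ofReal_ne_top), hfub]
  rw [surfaceMeasure, Measure.restrict_restrict hV.measurableSet]
  refine (lintegral_mono_set hsub).trans ((lintegral_image_le he hK' B hmφ).trans
    ((mul_le_mul_right hstrip _).trans (le_of_eq ?_)))
  rw [ENNReal.coe_mul, ENNReal.coe_mul, ENNReal.coe_mul, ENNReal.ofReal, ENNReal.ofReal]
  ring

/-- The trace inequality for smooth functions. -/
theorem exists_trace_inequality {Ω : Set (E d)} (hΩ : IsBoundedLipschitzDomain Ω) :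
    ∃ M : ℝ≥0, ∀ φ : E d → ℝ, ContDiff ℝ ∞ φ →
      ∫⁻ x, ENNReal.ofReal (φ x ^ 2) ∂(surfaceMeasure Ω) ≤
        M * ∫⁻ x in Ω, ENNReal.ofReal (energyDensity φ x) := by
  have hcomp : IsCompact (frontier Ω) :=
    hΩ.isBounded.isCompact_closure.of_isClosed_subset isClosed_frontier
      frontier_subset_closure
  have h : ∃ M : ℝ≥0, ∀ φ : E d → ℝ, ContDiff ℝ ∞ φ →
      ∫⁻ x in frontier Ω, ENNReal.ofReal (φ x ^ 2) ∂(surfaceMeasure Ω) ≤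
        M * ∫⁻ x in Ω, ENNReal.ofReal (energyDensity φ x) := by
    -- The existence of a constant for a set passes to subsets and finite unions, so the local
    -- estimates suffice.
    refine hcomp.induction_on
      (p := fun S => ∃ M : ℝ≥0, ∀ φ : E d → ℝ, ContDiff ℝ ∞ φ →
        ∫⁻ x in S, ENNReal.ofReal (φ x ^ 2) ∂(surfaceMeasure Ω) ≤
          M * ∫⁻ x in Ω, ENNReal.ofReal (energyDensity φ x)) ⟨0, fun φ _ => by simp⟩ ?_ ?_ ?_
    · rintro S T hST ⟨M, hM⟩
      exact ⟨M, fun φ hφ => (lintegral_mono_set hST).trans (hM φ hφ)⟩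
    · rintro S T ⟨M, hM⟩ ⟨N, hN⟩
      refine ⟨M + N, fun φ hφ => (lintegral_union_le _ _ _).trans ?_⟩
      rw [ENNReal.coe_add, add_mul]
      exact add_le_add (hM φ hφ) (hN φ hφ)
    · intro x hx
      obtain ⟨V, hV, hxV, hM⟩ := exists_local_trace_inequality hΩ.isOpen hΩ.lipschitz hx
      exact ⟨V, mem_nhdsWithin_of_mem_nhds (hV.mem_nhds hxV), hM⟩
  simpa only [surfaceMeasure, Measure.restrict_restrict isClosed_frontier.measurableSet,
    Set.inter_self] using h

/-! ### Approximation in L² -/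

section LpTools

variable {X : Type*} [MeasurableSpace X] {μ : Measure X}

theorem tendsto_eLpNorm_of_tendsto_eLpNorm_sub {φ : ℕ → X → ℝ} {u : Lp ℝ 2 μ}
    (hφ : ∀ k, AEStronglyMeasurable (φ k) μ)
    (h : Tendsto (fun k => eLpNorm (fun x => φ k x - u x) 2 μ) atTop (𝓝 0)) :
    Tendsto (fun k => eLpNorm (φ k) 2 μ) atTop (𝓝 ‖u‖ₑ) := by
  have hu := Lp.aestronglyMeasurable u
  have h1 : ∀ k, ‖u‖ₑ - eLpNorm (fun x => φ k x - u x) 2 μ ≤ eLpNorm (φ k) 2 μ := by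
    intro k
    rw [tsub_le_iff_left, Lp.enorm_def]
    have : (u : X → ℝ) = (fun x => u x - φ k x) + φ k := by ext x; simp
    conv_lhs => rw [this]
    refine (eLpNorm_add_le (hu.sub (hφ k)) (hφ k) (by norm_num)).trans (le_of_eq ?_)
    congr 1
    exact eLpNorm_sub_comm _ _ _ _
  have h2 : ∀ k, eLpNorm (φ k) 2 μ ≤ ‖u‖ₑ + eLpNorm (fun x => φ k x - u x) 2 μ := by
    intro k
    rw [Lp.enorm_def]
    have : φ k = u + fun x => φ k x - u x := by ext x; simp
    conv_lhs => rw [this]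
    exact eLpNorm_add_le hu ((hφ k).sub hu) (by norm_num)
  refine tendsto_of_tendsto_of_tendsto_of_le_of_le ?_ ?_ h1 h2
  · simpa using ENNReal.Tendsto.sub tendsto_const_nhds h (Or.inr (by simp))
  · simpa using tendsto_const_nhds.add h

theorem eLpNorm_sub_le_add_enorm {f : X → ℝ} (hf : AEStronglyMeasurable f μ) (u v : Lp ℝ 2 μ) :
    eLpNorm (fun x => f x - u x) 2 μ ≤ eLpNorm (fun x => f x - v x) 2 μ + ‖v - u‖ₑ := by
  have h : (fun x => f x - u x) =ᵐ[μ] (fun x => f x - v x) + ⇑(v - u) := by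
    filter_upwards [Lp.coeFn_sub v u] with x hx
    rw [Pi.add_apply, hx, Pi.sub_apply]
    ring
  rw [eLpNorm_congr_ae h, Lp.enorm_def]
  exact eLpNorm_add_le (hf.sub (Lp.aestronglyMeasurable v)) (Lp.aestronglyMeasurable _)
    (by norm_num)

theorem tendsto_eLpNorm_linearCombination_sub {φ ψ : ℕ → X → ℝ} {u v : Lp ℝ 2 μ}
    (hφ : ∀ k, AEStronglyMeasurable (φ k) μ) (hψ : ∀ k, AEStronglyMeasurable (ψ k) μ)
    (hu : Tendsto (fun k => eLpNorm (fun x => φ k x - u x) 2 μ) atTop (𝓝 0))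
    (hv : Tendsto (fun k => eLpNorm (fun x => ψ k x - v x) 2 μ) atTop (𝓝 0)) (s t : ℝ) :
    Tendsto (fun k => eLpNorm (fun x => (s * φ k x + t * ψ k x) - (s • u + t • v : Lp ℝ 2 μ) x) 2 μ)
      atTop (𝓝 0) := by
  have h : ∀ k, eLpNorm (fun x => (s * φ k x + t * ψ k x) - (s • u + t • v : Lp ℝ 2 μ) x) 2 μ ≤
      ‖s‖ₑ * eLpNorm (fun x => φ k x - u x) 2 μ + ‖t‖ₑ * eLpNorm (fun x => ψ k x - v x) 2 μ := by
    intro k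
    have he : (fun x => (s * φ k x + t * ψ k x) - (s • u + t • v : Lp ℝ 2 μ) x) =ᵐ[μ]
        s • (fun x => φ k x - u x) + t • (fun x => ψ k x - v x) := by
      filter_upwards [Lp.coeFn_add (s • u) (t • v), Lp.coeFn_smul s u, Lp.coeFn_smul t v]
        with x h1 h2 h3
      simp only [h1, Pi.add_apply, h2, h3, Pi.smul_apply, smul_eq_mul]
      ring
    rw [eLpNorm_congr_ae he, ← eLpNorm_const_smul, ← eLpNorm_const_smul]
    exact eLpNorm_add_le (((hφ k).sub (Lp.aestronglyMeasurable u)).const_smul s)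
      (((hψ k).sub (Lp.aestronglyMeasurable v)).const_smul t) (by norm_num)
  refine tendsto_of_tendsto_of_tendsto_of_le_of_le tendsto_const_nhds ?_ (fun _ => zero_le) h
  simpa using (ENNReal.Tendsto.const_mul hu (Or.inr enorm_ne_top)).add
    (ENNReal.Tendsto.const_mul hv (Or.inr enorm_ne_top))

theorem lintegral_ofReal_sq {f : X → ℝ} :
    ∫⁻ x, ENNReal.ofReal (f x ^ 2) ∂μ = eLpNorm f 2 μ ^ 2 := by
  have h := eLpNorm_nnreal_pow_eq_lintegral (μ := μ) (f := f) (p := 2) (by norm_num)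
  simp only [NNReal.coe_ofNat, ENNReal.rpow_ofNat, ENNReal.coe_ofNat] at h
  rw [h]
  refine lintegral_congr fun x => ?_
  rw [← ofReal_norm, ← ENNReal.ofReal_pow (norm_nonneg _), Real.norm_eq_abs, sq_abs]

theorem memLp_two_of_continuous_of_hasCompactSupport {Y : Type*} [TopologicalSpace Y]
    [MeasurableSpace Y] [OpensMeasurableSpace Y] [SecondCountableTopology Y] {ν : Measure Y}
    [IsFiniteMeasureOnCompacts ν] {f : Y → ℝ} (hf : Continuous f) (hc : HasCompactSupport f)
    (S : Set Y) : MemLp f 2 (ν.restrict S) :=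
  (hf.memLp_of_hasCompactSupport hc).restrict S

end LpTools

/-! ### Linearity and closedness of weak derivatives and traces -/

/-- Weak partial derivatives, expressed with the inner product of `L²(Ω)`. -/
theorem isWeakPartialDeriv_iff {Ω : Set (E d)} {i : Fin d} {f g : L2 Ω} :
    IsWeakPartialDeriv Ω i f g ↔ ∀ (ψ : E d → ℝ), ContDiff ℝ ∞ ψ → HasCompactSupport ψ →
      tsupport ψ ⊆ Ω → ∀ (h₀ : MemLp ψ 2 (volume.restrict Ω))
        (h₁ : MemLp (fun x => fderiv ℝ ψ x (unitVec i)) 2 (volume.restrict Ω)),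
      inner ℝ h₁.toLp f + inner ℝ h₀.toLp g = (0 : ℝ) := by
  have key : ∀ {ψ : E d → ℝ} (h₀ : MemLp ψ 2 (volume.restrict Ω)) (u : L2 Ω),
      inner ℝ h₀.toLp u = ∫ x in Ω, u x * ψ x := by
    intro ψ h₀ u
    rw [L2.inner_def]
    refine integral_congr_ae ?_
    filter_upwards [h₀.coeFn_toLp] with x hx
    simp [hx]
  constructor
  · intro h ψ hψ hc hs h₀ h₁
    rw [key, key, h ψ hψ hc hs]
    ring
  · intro h ψ hψ hc hs
    have hd : Continuous (fderiv ℝ ψ) := hψ.continuous_fderiv (by simp)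
    have h₀ := memLp_two_of_continuous_of_hasCompactSupport (ν := volume) hψ.continuous hc Ω
    have h₁ : MemLp (fun x => fderiv ℝ ψ x (unitVec i)) 2 (volume.restrict Ω) :=
      memLp_two_of_continuous_of_hasCompactSupport (ν := volume) (by fun_prop)
        (hc.fderiv_apply ℝ (unitVec i)) Ω
    have := h ψ hψ hc hs h₀ h₁
    rw [key, key] at this
    linarith

theorem IsWeakPartialDeriv.linearCombination {Ω : Set (E d)} {i : Fin d} {f g f' g' : L2 Ω}
    (h : IsWeakPartialDeriv Ω i f g) (h' : IsWeakPartialDeriv Ω i f' g') (s t : ℝ) :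
    IsWeakPartialDeriv Ω i (s • f + t • f') (s • g + t • g') := by
  rw [isWeakPartialDeriv_iff] at *
  intro ψ hψ hc hs h₀ h₁
  have e := h ψ hψ hc hs h₀ h₁
  have e' := h' ψ hψ hc hs h₀ h₁
  simp only [inner_add_right, inner_smul_right]
  linear_combination s * e + t * e'

/-- Each test function imposes a condition that is continuous in the pair (f, g) with respect to L²
convergence. -/
theorem IsWeakPartialDeriv.of_tendsto {Ω : Set (E d)} {i : Fin d} {f g : ℕ → L2 Ω} {F G : L2 Ω}
    (h : ∀ n, IsWeakPartialDeriv Ω i (f n) (g n)) (hf : Tendsto f atTop (𝓝 F))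
    (hg : Tendsto g atTop (𝓝 G)) : IsWeakPartialDeriv Ω i F G := by
  rw [isWeakPartialDeriv_iff]
  intro ψ hψ hc hs h₀ h₁
  refine tendsto_nhds_unique ((tendsto_const_nhds.inner hf).add (tendsto_const_nhds.inner hg)) ?_
  simp only [isWeakPartialDeriv_iff.1 (h _) ψ hψ hc hs h₀ h₁, tendsto_const_nhds]

/-- Linear combinations in `H¹(Ω)`. -/
noncomputable def H1.linearCombination {Ω : Set (E d)} (s t : ℝ) (y z : H1 Ω) : H1 Ω where
  fn := s • y.fn + t • z.fn
  grad i := s • y.grad i + t • z.grad i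
  isWeakPartialDeriv i := (y.isWeakPartialDeriv i).linearCombination (z.isWeakPartialDeriv i) s t

/-- The zero element of `H¹(Ω)`. -/
noncomputable def H1.zero {Ω : Set (E d)} : H1 Ω where
  fn := 0
  grad _ := 0
  isWeakPartialDeriv i := by
    rw [isWeakPartialDeriv_iff]
    intros
    simp

theorem isTrace_zero {Ω : Set (E d)} : IsTrace (H1.zero : H1 Ω) 0 := by
  refine ⟨fun _ _ => 0, fun _ => contDiff_const, ⟨?_, fun i => ?_⟩, ?_⟩
  all_goals
    refine tendsto_const_nhds.congr fun k => ?_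
    rw [← eLpNorm_zero (α := E d) (ε := ℝ) (p := 2)]
    refine (eLpNorm_congr_ae ?_)
  · filter_upwards [Lp.coeFn_zero ℝ 2 (volume.restrict Ω)] with x hx
    change (0 : ℝ) = 0 - (0 : L2 Ω) x
    rw [hx, Pi.zero_apply, sub_zero]
  · filter_upwards [Lp.coeFn_zero ℝ 2 (volume.restrict Ω)] with x hx
    change (0 : ℝ) = fderiv ℝ (fun _ : E d => (0 : ℝ)) x (unitVec i) - (0 : L2 Ω) x
    rw [hx, Pi.zero_apply, sub_zero, fderiv_fun_const]
    rfl
  · filter_upwards [Lp.coeFn_zero ℝ 2 (surfaceMeasure Ω)] with x hx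
    rw [hx, Pi.zero_apply, sub_zero]

theorem aestronglyMeasurable_fderiv_apply {φ : E d → ℝ} (hφ : ContDiff ℝ ∞ φ) (e : E d)
    (μ : Measure (E d)) : AEStronglyMeasurable (fun x => fderiv ℝ φ x e) μ := by
  have hd : Continuous (fderiv ℝ φ) := hφ.continuous_fderiv (by simp)
  exact Continuous.aestronglyMeasurable (by fun_prop)

theorem IsTrace.linearCombination {Ω : Set (E d)} {y z : H1 Ω} {g h : L2Boundary Ω}
    (hy : IsTrace y g) (hz : IsTrace z h) (s t : ℝ) :
    IsTrace (H1.linearCombination s t y z) (s • g + t • h) := by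
  obtain ⟨φ, hφ, ⟨hφ₀, hφ₁⟩, hφ₂⟩ := hy
  obtain ⟨ψ, hψ, ⟨hψ₀, hψ₁⟩, hψ₂⟩ := hz
  refine ⟨fun k x => s * φ k x + t * ψ k x,
    fun k => (contDiff_const.mul (hφ k)).add (contDiff_const.mul (hψ k)), ⟨?_, fun i => ?_⟩, ?_⟩
  · exact tendsto_eLpNorm_linearCombination_sub
      (fun k => (hφ k).continuous.aestronglyMeasurable)
      (fun k => (hψ k).continuous.aestronglyMeasurable) hφ₀ hψ₀ s t
  · have hd : ∀ k x, fderiv ℝ (fun x => s * φ k x + t * ψ k x) x (unitVec i) =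
        s * fderiv ℝ (φ k) x (unitVec i) + t * fderiv ℝ (ψ k) x (unitVec i) := by
      intro k x
      have h1 := (hφ k).differentiable (by simp) x
      have h2 := (hψ k).differentiable (by simp) x
      rw [fderiv_fun_add (h1.const_mul s) (h2.const_mul t), fderiv_const_mul h1,
        fderiv_const_mul h2]
      simp
    simp only [hd]
    exact tendsto_eLpNorm_linearCombination_sub
      (fun k => aestronglyMeasurable_fderiv_apply (hφ k) _ _)
      (fun k => aestronglyMeasurable_fderiv_apply (hψ k) _ _) (hφ₁ i) (hψ₁ i) s t
  · exact tendsto_eLpNorm_linearCombination_sub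
      (fun k => (hφ k).continuous.aestronglyMeasurable)
      (fun k => (hψ k).continuous.aestronglyMeasurable) hφ₂ hψ₂ s t

/-- The graph of the trace operator is closed. -/
theorem IsTrace.of_tendsto {Ω : Set (E d)} {y : ℕ → H1 Ω} {g : ℕ → L2Boundary Ω} {Y : H1 Ω}
    {G : L2Boundary Ω} (h : ∀ n, IsTrace (y n) (g n))
    (hfn : Tendsto (fun n => (y n).fn) atTop (𝓝 Y.fn))
    (hgrad : ∀ i, Tendsto (fun n => (y n).grad i) atTop (𝓝 (Y.grad i)))
    (hg : Tendsto g atTop (𝓝 G)) : IsTrace Y G := by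
  have hε : ∀ n : ℕ, (0 : ℝ≥0∞) < ((n : ℝ≥0∞) + 1)⁻¹ := fun n => by
    rw [ENNReal.inv_pos]; finiteness
  -- Diagonal argument: for each n a single smooth function is chosen close to `y n` in all the
  -- norms at once.
  have hφ : ∀ n, ∃ φ : E d → ℝ, ContDiff ℝ ∞ φ ∧
      eLpNorm (fun x => φ x - (y n).fn x) 2 (volume.restrict Ω) < ((n : ℝ≥0∞) + 1)⁻¹ ∧
      (∀ i, eLpNorm (fun x => fderiv ℝ φ x (unitVec i) - (y n).grad i x) 2 (volume.restrict Ω) <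
        ((n : ℝ≥0∞) + 1)⁻¹) ∧
      eLpNorm (fun x => φ x - g n x) 2 (surfaceMeasure Ω) < ((n : ℝ≥0∞) + 1)⁻¹ := by
    intro n
    obtain ⟨φ, hφ, ⟨h₀, h₁⟩, h₂⟩ := h n
    have e := (h₀.eventually_lt_const (hε n)).and
      ((eventually_all.2 fun i => (h₁ i).eventually_lt_const (hε n)).and
        (h₂.eventually_lt_const (hε n)))
    obtain ⟨k, hk⟩ := e.exists
    exact ⟨φ k, hφ k, hk⟩
  choose φ hφ h₀ h₁ h₂ using hφ
  have hlim : Tendsto (fun n : ℕ => ((n : ℝ≥0∞) + 1)⁻¹) atTop (𝓝 0) := by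
    have := (tendsto_add_atTop_iff_nat 1).2 ENNReal.tendsto_inv_nat_nhds_zero
    simpa using this
  have aux : ∀ {μ : Measure (E d)} {f : ℕ → E d → ℝ} {u : ℕ → Lp ℝ 2 μ} {v : Lp ℝ 2 μ},
      (∀ n, AEStronglyMeasurable (f n) μ) → Tendsto u atTop (𝓝 v) →
      (∀ n : ℕ, eLpNorm (fun x => f n x - u n x) 2 μ < ((n : ℝ≥0∞) + 1)⁻¹) →
      Tendsto (fun n => eLpNorm (fun x => f n x - v x) 2 μ) atTop (𝓝 0) := by
    intro μ f u v hf hu hfu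
    have hz : Tendsto (fun n => ‖u n - v‖ₑ) atTop (𝓝 0) := by
      have := ((hu.sub_const v)).enorm
      simpa using this
    refine tendsto_of_tendsto_of_tendsto_of_le_of_le tendsto_const_nhds ?_ (fun _ => zero_le)
      fun n => (eLpNorm_sub_le_add_enorm (hf n) v (u n)).trans (add_le_add (hfu n).le le_rfl)
    simpa using hlim.add hz
  exact ⟨φ, hφ, ⟨aux (fun n => (hφ n).continuous.aestronglyMeasurable) hfn h₀,
    fun i => aux (fun n => aestronglyMeasurable_fderiv_apply (hφ n) _ _) (hgrad i)
      fun n => h₁ n i⟩, aux (fun n => (hφ n).continuous.aestronglyMeasurable) hg h₂⟩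

/-- The trace inequality. -/
theorem exists_norm_trace_le {Ω : Set (E d)} (hΩ : IsBoundedLipschitzDomain Ω) :
    ∃ M : ℝ≥0, ∀ (y : H1 Ω) (g : L2Boundary Ω), IsTrace y g →
      ‖g‖ ^ 2 ≤ M * (‖y.fn‖ ^ 2 + ∑ i, ‖y.grad i‖ ^ 2) := by
  obtain ⟨M, hM⟩ := exists_trace_inequality hΩ
  refine ⟨M, ?_⟩
  rintro y g ⟨φ, hφ, ⟨h₀, h₁⟩, h₂⟩
  have hk : ∀ k, eLpNorm (φ k) 2 (surfaceMeasure Ω) ^ 2 ≤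
      M * (eLpNorm (φ k) 2 (volume.restrict Ω) ^ 2 +
        ∑ i, eLpNorm (fun x => fderiv ℝ (φ k) x (unitVec i)) 2 (volume.restrict Ω) ^ 2) := by
    intro k
    refine (le_of_eq lintegral_ofReal_sq.symm).trans ((hM (φ k) (hφ k)).trans (le_of_eq ?_))
    congr 1
    have hd : Continuous (fderiv ℝ (φ k)) := (hφ k).continuous_fderiv (by simp)
    have hm : ∀ i, Measurable fun x => ENNReal.ofReal (fderiv ℝ (φ k) x (unitVec i) ^ 2) :=
      fun i => (Continuous.measurable (by fun_prop)).ennreal_ofReal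
    have hm₀ : Measurable fun x => ENNReal.ofReal (φ k x ^ 2) :=
      ((hφ k).continuous.pow 2).measurable.ennreal_ofReal
    simp only [energyDensity]
    simp_rw [ENNReal.ofReal_add (sq_nonneg _) (Finset.sum_nonneg fun _ _ => sq_nonneg _),
      ENNReal.ofReal_sum_of_nonneg fun _ _ => sq_nonneg _]
    rw [lintegral_add_left hm₀, lintegral_finsetSum _ fun i _ => hm i]
    simp only [lintegral_ofReal_sq]
  have hlim := le_of_tendsto_of_tendsto'
    (ENNReal.Tendsto.pow (n := 2) (tendsto_eLpNorm_of_tendsto_eLpNorm_sub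
      (fun k => (hφ k).continuous.aestronglyMeasurable) h₂))
    (ENNReal.Tendsto.const_mul ((ENNReal.Tendsto.pow (n := 2)
      (tendsto_eLpNorm_of_tendsto_eLpNorm_sub
        (fun k => (hφ k).continuous.aestronglyMeasurable) h₀)).add
      (tendsto_finsetSum _ fun i _ => ENNReal.Tendsto.pow (n := 2)
        (tendsto_eLpNorm_of_tendsto_eLpNorm_sub
          (fun k => aestronglyMeasurable_fderiv_apply (hφ k) _ _) (h₁ i))))
      (Or.inr ENNReal.coe_ne_top)) hk
  simp only [enorm_eq_nnnorm] at hlim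
  have hlim' : ‖g‖₊ ^ 2 ≤ M * (‖y.fn‖₊ ^ 2 + ∑ i, ‖y.grad i‖₊ ^ 2) := by exact_mod_cast hlim
  simpa using NNReal.coe_le_coe.2 hlim'

/-! ### Multiplication operators and ellipticity -/

section Mul

variable {X : Type*} [MeasurableSpace X] {μ : Measure X}

/-- Multiplication by a bounded function on `L²`. -/
noncomputable def mulL {c : X → ℝ} (hc : MemLp c ∞ μ) : Lp ℝ 2 μ →L[ℝ] Lp ℝ 2 μ :=
  (ContinuousLinearMap.mul ℝ ℝ).holderL μ ∞ 2 2 hc.toLp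

theorem coeFn_mulL {c : X → ℝ} (hc : MemLp c ∞ μ) (f : Lp ℝ 2 μ) :
    mulL hc f =ᵐ[μ] fun x => c x * f x := by
  refine ((ContinuousLinearMap.mul ℝ ℝ).coeFn_holder hc.toLp f).trans ?_
  filter_upwards [hc.coeFn_toLp] with x hx
  simp [hx]

theorem inner_mulL_ae {c : X → ℝ} (hc : MemLp c ∞ μ) (f g : Lp ℝ 2 μ) :
    (fun x => inner ℝ (g x) (mulL hc f x)) =ᵐ[μ] fun x => c x * f x * g x := by
  filter_upwards [coeFn_mulL hc f] with x hx
  simp [hx]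

theorem inner_mulL {c : X → ℝ} (hc : MemLp c ∞ μ) (f g : Lp ℝ 2 μ) :
    inner ℝ g (mulL hc f) = ∫ x, c x * f x * g x ∂μ := by
  rw [L2.inner_def]
  exact integral_congr_ae (inner_mulL_ae hc f g)

theorem integrable_mul_mul {c : X → ℝ} (hc : MemLp c ∞ μ) (f g : Lp ℝ 2 μ) :
    Integrable (fun x => c x * f x * g x) μ :=
  (L2.integrable_inner g (mulL hc f)).congr (inner_mulL_ae hc f g)

theorem inner_mulL_self_nonneg {c : X → ℝ} (hc : MemLp c ∞ μ) (h : ∀ᵐ x ∂μ, 0 ≤ c x)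
    (f : Lp ℝ 2 μ) : 0 ≤ inner ℝ f (mulL hc f) := by
  rw [inner_mulL]
  refine integral_nonneg_of_ae ?_
  filter_upwards [h] with x hx
  rw [mul_assoc]
  exact mul_nonneg hx (mul_self_nonneg _)

theorem norm_sq_eq_integral (f : Lp ℝ 2 μ) : ‖f‖ ^ 2 = ∫ x, f x ^ 2 ∂μ := by
  rw [← real_inner_self_eq_norm_sq, L2.inner_def]
  simp [pow_two]

theorem integrable_sq (f : Lp ℝ 2 μ) : Integrable (fun x => f x ^ 2) μ :=
  (Lp.memLp f).integrable_sq

/-- Pointwise ellipticity at ξ = (zᵢ(x)) is integrated; bounded coefficients make every term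
integrable. -/
theorem mul_sum_norm_sq_le {C : X → Matrix (Fin d) (Fin d) ℝ}
    (hC : ∀ i j, MemLp (fun x => C x i j) ∞ μ) {c₀ : ℝ}
    (hell : ∀ᵐ x ∂μ, ∀ ξ : Fin d → ℝ, c₀ * (ξ ⬝ᵥ ξ) ≤ ξ ⬝ᵥ (C x *ᵥ ξ)) (z : Fin d → Lp ℝ 2 μ) :
    c₀ * ∑ i, ‖z i‖ ^ 2 ≤ ∑ i, ∑ j, inner ℝ (z i) (mulL (hC i j) (z j)) := by
  simp only [norm_sq_eq_integral, inner_mulL]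
  rw [← integral_finsetSum _ fun i _ => integrable_sq (z i), ← integral_const_mul]
  simp_rw [← integral_finsetSum Finset.univ fun j _ => integrable_mul_mul (hC _ j) (z j) (z _)]
  rw [← integral_finsetSum _ fun i _ => integrable_finsetSum _ fun j _ =>
    integrable_mul_mul (hC i j) (z j) (z i)]
  refine integral_mono_ae ((integrable_finsetSum _ fun i _ => integrable_sq (z i)).const_mul _)
    (integrable_finsetSum _ fun i _ => integrable_finsetSum _ fun j _ =>
      integrable_mul_mul (hC i j) (z j) (z i)) ?_
  filter_upwards [hell] with x hx
  have h := hx fun i => z i x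
  simp only [dotProduct, Matrix.mulVec, Finset.mul_sum] at h ⊢
  refine (le_of_eq ?_).trans (h.trans (le_of_eq ?_))
  · exact Finset.sum_congr rfl fun i _ => by ring
  · exact Finset.sum_congr rfl fun i _ => Finset.sum_congr rfl fun j _ => by ring

end Mul

/-! ### The Robin problem and closedness of its solution space -/

section Form

variable {Ω : Set (E d)} {C : E d → Matrix (Fin d) (Fin d) ℝ}
  (hC : ∀ i j, MemLp (fun x => C x i j) ∞ (volume.restrict Ω))
  {a : E d → ℝ} (ha : MemLp a ∞ (volume.restrict Ω))
  {q : E d → ℝ} (hq : MemLp q ∞ (surfaceMeasure Ω))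

/-- The bilinear form of the Robin problem, evaluated at `y`, `w ∈ H¹(Ω)` with traces `g`, `h`. -/
noncomputable def robinForm (y : H1 Ω) (g : L2Boundary Ω) (w : H1 Ω) (h : L2Boundary Ω) : ℝ :=
  (∑ i, ∑ j, inner ℝ (w.grad i) (mulL (hC i j) (y.grad j))) +
    inner ℝ w.fn (mulL ha y.fn) + inner ℝ h (mulL hq g)

theorem robinForm_eq (y : H1 Ω) (g : L2Boundary Ω) (w : H1 Ω) (h : L2Boundary Ω) :
    robinForm hC ha hq y g w h =
      (∫ x in Ω, ((C x *ᵥ fun j => y.grad j x) ⬝ᵥ (fun i => w.grad i x)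
          + a x * y.fn x * w.fn x)) + ∫ x, q x * g x * h x ∂(surfaceMeasure Ω) := by
  have hint : ∀ i, Integrable (fun x => ∑ j, C x i j * y.grad j x * w.grad i x)
      (volume.restrict Ω) := fun i =>
    integrable_finsetSum _ fun j _ => integrable_mul_mul (hC i j) (y.grad j) (w.grad i)
  have hsum : ∀ x, (C x *ᵥ fun j => y.grad j x) ⬝ᵥ (fun i => w.grad i x) =
      ∑ i, ∑ j, C x i j * y.grad j x * w.grad i x := fun x => by
    simp only [dotProduct, Matrix.mulVec, Finset.sum_mul]
  simp only [robinForm, inner_mulL, hsum]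
  rw [integral_add (integrable_finsetSum _ fun i _ => hint i) (integrable_mul_mul ha _ _),
    integral_finsetSum _ fun i _ => hint i]
  congr 2
  refine Finset.sum_congr rfl fun i _ => ?_
  rw [integral_finsetSum _ fun j _ => integrable_mul_mul (hC i j) (y.grad j) (w.grad i)]

/-- Inner products and bounded operators on L² make linearity and passage to the limit in the weak
formulation immediate. -/
theorem isWeakSolution_iff {f : E d → ℝ} {F : L2 Ω} (hF : F =ᵐ[volume.restrict Ω] f)
    (y : H1 Ω) : IsWeakSolution C a q f y ↔ ∃ g : L2Boundary Ω, IsTrace y g ∧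
      ∀ (w : H1 Ω) (h : L2Boundary Ω), IsTrace w h →
        robinForm hC ha hq y g w h = inner ℝ w.fn F := by
  have hr : ∀ w : H1 Ω, ∫ x in Ω, f x * w.fn x = inner ℝ w.fn F := fun w => by
    rw [L2.inner_def]
    refine integral_congr_ae ?_
    filter_upwards [hF] with x hx
    simp [hx]
  simp only [IsWeakSolution, hr, robinForm_eq]

/-- The pairs of a state and a right-hand side in `L²(Ω)` that solve the Robin problem. -/
noncomputable def solutionSpace : Submodule ℝ (L2 Ω × L2 Ω) where
  carrier := {p | ∃ y : H1 Ω, y.fn = p.1 ∧ ∃ g : L2Boundary Ω, IsTrace y g ∧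
    ∀ (w : H1 Ω) (h : L2Boundary Ω), IsTrace w h →
      robinForm hC ha hq y g w h = inner ℝ w.fn p.2}
  zero_mem' := ⟨H1.zero, rfl, 0, isTrace_zero, fun w h _ => by simp [robinForm, H1.zero]⟩
  add_mem' := by
    rintro p p' ⟨y, hy, g, hg, h⟩ ⟨y', hy', g', hg', h'⟩
    refine ⟨H1.linearCombination 1 1 y y', by simp [H1.linearCombination, hy, hy'], _,
      hg.linearCombination hg' 1 1, fun w k hk => ?_⟩
    have e := h w k hk
    have e' := h' w k hk
    simp only [robinForm, H1.linearCombination, one_smul, map_add, inner_add_right,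
      Finset.sum_add_distrib, Prod.snd_add] at e e' ⊢
    linear_combination e + e'
  smul_mem' := by
    rintro s p ⟨y, hy, g, hg, h⟩
    refine ⟨H1.linearCombination s 0 y y, by simp [H1.linearCombination, hy], _,
      hg.linearCombination hg s 0, fun w k hk => ?_⟩
    have e := h w k hk
    simp only [robinForm, H1.linearCombination, zero_smul, add_zero, map_smul, inner_smul_right,
      ← Finset.mul_sum, Prod.smul_snd] at e ⊢
    linear_combination s * e

variable {hC ha hq}

/-- The energy estimate. -/
theorem mul_sum_norm_grad_sq_le {c₀ : ℝ}
    (hell : ∀ᵐ x ∂(volume.restrict Ω), ∀ ξ : Fin d → ℝ, c₀ * (ξ ⬝ᵥ ξ) ≤ ξ ⬝ᵥ (C x *ᵥ ξ))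
    (ha0 : ∀ᵐ x ∂(volume.restrict Ω), 0 ≤ a x) (hq0 : ∀ᵐ x ∂(surfaceMeasure Ω), 0 ≤ q x)
    {y : H1 Ω} {g : L2Boundary Ω} {F : L2 Ω} (h : robinForm hC ha hq y g y g = inner ℝ y.fn F) :
    c₀ * ∑ i, ‖y.grad i‖ ^ 2 ≤ ‖y.fn‖ * ‖F‖ := by
  refine le_trans ?_ (real_inner_le_norm y.fn F)
  rw [← h, robinForm]
  have h1 := mul_sum_norm_sq_le hC hell y.grad
  have h2 := inner_mulL_self_nonneg ha ha0 y.fn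
  have h3 := inner_mulL_self_nonneg hq hq0 g
  linarith

theorem cauchySeq_of_norm_sub_sq_le {V W : Type*} [NormedAddCommGroup V] [NormedAddCommGroup W]
    {u : ℕ → V} {v : ℕ → W} (hv : CauchySeq v) {b : ℝ} (hb : 0 ≤ b)
    (h : ∀ n m, ‖u n - u m‖ ^ 2 ≤ b * ‖v n - v m‖ ^ 2) : CauchySeq u := by
  have h' : ∀ n m, dist (u n) (u m) ≤ √b * dist (v n) (v m) := fun n m => by
    rw [dist_eq_norm, dist_eq_norm]
    refine le_of_sq_le_sq ?_ (by positivity)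
    rw [mul_pow, Real.sq_sqrt hb]
    exact h n m
  rw [Metric.cauchySeq_iff'] at hv ⊢
  intro ε hε
  -- The added 1 keeps the denominator positive when b = 0.
  obtain ⟨N, hN⟩ := hv (ε / (√b + 1)) (by positivity)
  refine ⟨N, fun n hn => (h' n N).trans_lt ?_⟩
  have h1 := hN n hn
  rw [lt_div_iff₀ (by positivity)] at h1
  nlinarith [dist_nonneg (x := v n) (y := v N)]

/-- The solution space is closed: gradients converge by the energy estimate, and traces converge by
the trace inequality. -/
theorem isClosed_solutionSpace (hΩ : IsBoundedLipschitzDomain Ω) {c₀ : ℝ} (hc₀ : 0 < c₀)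
    (hell : ∀ᵐ x ∂(volume.restrict Ω), ∀ ξ : Fin d → ℝ, c₀ * (ξ ⬝ᵥ ξ) ≤ ξ ⬝ᵥ (C x *ᵥ ξ))
    (ha0 : ∀ᵐ x ∂(volume.restrict Ω), 0 ≤ a x) (hq0 : ∀ᵐ x ∂(surfaceMeasure Ω), 0 ≤ q x) :
    IsClosed (solutionSpace hC ha hq : Set (L2 Ω × L2 Ω)) := by
  obtain ⟨M, hM⟩ := exists_norm_trace_le hΩ
  refine IsSeqClosed.isClosed fun p P hp hpP => ?_
  choose y hy g hg hsol using hp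
  have hcauchy := hpP.cauchySeq
  have hdiff : ∀ n m, IsTrace (H1.linearCombination 1 (-1) (y n) (y m)) (g n - g m) := fun n m => by
    simpa [sub_eq_add_neg] using (hg n).linearCombination (hg m) 1 (-1)
  have hDfn : ∀ n m, (H1.linearCombination 1 (-1) (y n) (y m)).fn = (p n - p m).1 :=
    fun n m => by simp [H1.linearCombination, hy, sub_eq_add_neg]
  have hDgrad : ∀ n m i, (H1.linearCombination 1 (-1) (y n) (y m)).grad i =
      (y n).grad i - (y m).grad i :=
    fun n m i => by simp [H1.linearCombination, sub_eq_add_neg]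
  have henergy : ∀ n m, ∑ i, ‖(y n).grad i - (y m).grad i‖ ^ 2 ≤ c₀⁻¹ * ‖p n - p m‖ ^ 2 := by
    intro n m
    -- The equation for the difference of two states is tested with that difference itself.
    have hform : robinForm hC ha hq (H1.linearCombination 1 (-1) (y n) (y m)) (g n - g m)
        (H1.linearCombination 1 (-1) (y n) (y m)) (g n - g m) =
        inner ℝ (H1.linearCombination 1 (-1) (y n) (y m)).fn (p n - p m).2 := by
      have e := hsol n _ _ (hdiff n m)
      have e' := hsol m _ _ (hdiff n m)
      rw [Prod.snd_sub, inner_sub_right, ← e, ← e']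
      simp only [robinForm, hDgrad, map_sub, inner_sub_right, Finset.sum_sub_distrib]
      simp only [hDfn, Prod.fst_sub, map_sub, inner_sub_right, ← hy]
      ring
    have h := mul_sum_norm_grad_sq_le hell ha0 hq0 hform
    simp only [hDgrad, hDfn] at h
    rw [inv_mul_eq_div, le_div_iff₀ hc₀, mul_comm, pow_two]
    exact h.trans (mul_le_mul (norm_fst_le _) (norm_snd_le _) (norm_nonneg _) (norm_nonneg _))
  have hgrad : ∀ i, CauchySeq fun n => (y n).grad i := fun i =>
    cauchySeq_of_norm_sub_sq_le hcauchy (inv_nonneg.2 hc₀.le) fun n m =>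
      (Finset.single_le_sum (f := fun i => ‖(y n).grad i - (y m).grad i‖ ^ 2)
        (fun _ _ => sq_nonneg _) (Finset.mem_univ i)).trans (henergy n m)
  have htrace : CauchySeq g := by
    -- In the trace inequality, 1 accounts for the L² norm of the difference and c₀⁻¹ for its
    -- gradient.
    refine cauchySeq_of_norm_sub_sq_le hcauchy (b := M * (1 + c₀⁻¹)) (by positivity) fun n m => ?_
    refine (hM _ _ (hdiff n m)).trans ?_
    simp only [hDgrad, hDfn]
    rw [mul_assoc, add_mul, one_mul]
    refine mul_le_mul_of_nonneg_left (add_le_add ?_ (henergy n m)) M.2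
    exact pow_le_pow_left₀ (norm_nonneg _) (norm_fst_le _) 2
  choose G hG using fun i => cauchySeq_tendsto_of_complete (hgrad i)
  obtain ⟨T, hT⟩ := cauchySeq_tendsto_of_complete htrace
  have hfn : Tendsto (fun n => (y n).fn) atTop (𝓝 P.1) := by
    simp only [hy]
    exact (continuous_fst.tendsto P).comp hpP
  have hrhs : Tendsto (fun n => (p n).2) atTop (𝓝 P.2) := (continuous_snd.tendsto P).comp hpP
  let Y : H1 Ω := ⟨P.1, G, fun i =>
    IsWeakPartialDeriv.of_tendsto (fun n => (y n).isWeakPartialDeriv i) hfn (hG i)⟩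
  refine ⟨Y, rfl, T, IsTrace.of_tendsto (Y := Y) hg hfn hG hT, fun w h hwh => ?_⟩
  have hlim : Tendsto (fun n => robinForm hC ha hq (y n) (g n) w h) atTop
      (𝓝 (robinForm hC ha hq Y T w h)) := by
    refine ((tendsto_finsetSum _ fun i _ => tendsto_finsetSum _ fun j _ => ?_).add ?_).add ?_
    · exact tendsto_const_nhds.inner (((mulL (hC i j)).continuous.tendsto _).comp (hG j))
    · exact tendsto_const_nhds.inner (((mulL ha).continuous.tendsto _).comp hfn)
    · exact tendsto_const_nhds.inner (((mulL hq).continuous.tendsto _).comp hT)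
  refine tendsto_nhds_unique hlim ?_
  simp only [hsol _ w h hwh]
  exact tendsto_const_nhds.inner hrhs

end Form

/-! ### Controls with prescribed supports -/

section Controls

variable {X : Type*} [MeasurableSpace X] {μ : Measure X}

/-- The indicator function of a set, as a bounded function. -/
theorem memLp_top_indicator_one {A : Set X} (hA : NullMeasurableSet A μ) :
    MemLp (A.indicator fun _ => (1 : ℝ)) ∞ μ := by
  refine memLp_top_of_bound (aestronglyMeasurable_const.indicator₀ hA) 1
    (Eventually.of_forall fun x => ?_)
  by_cases h : x ∈ A <;> simp [h]

theorem coeFn_mulL_indicator {A : Set X} (hA : NullMeasurableSet A μ) (f : Lp ℝ 2 μ) :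
    mulL (memLp_top_indicator_one hA) f =ᵐ[μ] A.indicator fun x => f x := by
  filter_upwards [coeFn_mulL (memLp_top_indicator_one hA) f] with x hx
  by_cases h : x ∈ A <;> simp [hx, h]

/-- The nonnegative functions in `L²` that vanish outside a given set. -/
def nonnegSupportedOn (μ : Measure X) (A : Set X) : Set (Lp ℝ 2 μ) :=
  {u | ∀ᵐ x ∂μ, 0 ≤ u x ∧ (x ∉ A → u x = 0)}

/-- An L²-convergent sequence has an a.e. convergent subsequence, along which sign and support
conditions persist. -/
theorem isClosed_nonnegSupportedOn (A : Set X) : IsClosed (nonnegSupportedOn μ A) := by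
  refine IsSeqClosed.isClosed fun u v hu huv => ?_
  obtain ⟨ns, -, hns⟩ := (tendstoInMeasure_of_tendsto_Lp huv).exists_seq_tendsto_ae
  filter_upwards [hns, ae_all_iff.2 hu] with x hx hux
  refine ⟨ge_of_tendsto' hx fun k => (hux _).1, fun hxA => ?_⟩
  refine tendsto_nhds_unique hx ?_
  simp only [(hux _).2 hxA, tendsto_const_nhds]

theorem convex_nonnegSupportedOn (A : Set X) : Convex ℝ (nonnegSupportedOn μ A) := by
  intro u hu v hv s t hs ht _
  filter_upwards [hu, hv, Lp.coeFn_add (s • u) (t • v), Lp.coeFn_smul s u, Lp.coeFn_smul t v]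
    with x hux hvx h1 h2 h3
  simp only [h1, Pi.add_apply, h2, h3, Pi.smul_apply, smul_eq_mul]
  refine ⟨add_nonneg (mul_nonneg hs hux.1) (mul_nonneg ht hvx.1), fun hx => ?_⟩
  rw [hux.2 hx, hvx.2 hx]
  simp

theorem zero_mem_nonnegSupportedOn (A : Set X) : 0 ∈ nonnegSupportedOn μ A := by
  filter_upwards [Lp.coeFn_zero ℝ 2 μ] with x hx
  rw [hx]
  simp

theorem smul_mem_nonnegSupportedOn {A : Set X} {u : Lp ℝ 2 μ} (hu : u ∈ nonnegSupportedOn μ A)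
    {s : ℝ} (hs : 0 ≤ s) : s • u ∈ nonnegSupportedOn μ A := by
  filter_upwards [hu, Lp.coeFn_smul s u] with x hux h
  rw [h, Pi.smul_apply, smul_eq_mul]
  exact ⟨mul_nonneg hs hux.1, fun hx => by rw [hux.2 hx, mul_zero]⟩

/-- The right-hand side of the state equation, as a function of the controls. -/
noncomputable def controlToRhs {A B : Set X} (hA : NullMeasurableSet A μ)
    (hB : NullMeasurableSet B μ) : Lp ℝ 2 μ × Lp ℝ 2 μ →L[ℝ] Lp ℝ 2 μ :=
  (mulL (memLp_top_indicator_one hA)).coprod (mulL (memLp_top_indicator_one hB))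

theorem coeFn_controlToRhs {A B : Set X} (hA : NullMeasurableSet A μ)
    (hB : NullMeasurableSet B μ) (u v : Lp ℝ 2 μ) :
    controlToRhs hA hB (u, v) =ᵐ[μ]
      fun x => A.indicator (fun x => u x) x + B.indicator (fun x => v x) x := by
  rw [controlToRhs, ContinuousLinearMap.coprod_apply]
  filter_upwards [Lp.coeFn_add (mulL (memLp_top_indicator_one hA) u)
    (mulL (memLp_top_indicator_one hB) v), coeFn_mulL_indicator hA u, coeFn_mulL_indicator hB v]
    with x h1 h2 h3
  rw [h1, Pi.add_apply, h2, h3]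

/-- Complementary controls can be replaced by controls with prescribed disjoint supports that
produce the same right-hand side and are not more expensive. -/
theorem exists_nonnegSupportedOn_of_complementary {A B : Set X} (hA : NullMeasurableSet A μ)
    (hB : NullMeasurableSet B μ) (hAB : ∀ᵐ x ∂μ, x ∈ A ∪ B) {α₁ α₂ : ℝ} (hα₁ : 0 < α₁)
    (hα : α₁ ≤ α₂) {u v : Lp ℝ 2 μ} (h : ∀ᵐ x ∂μ, 0 ≤ u x ∧ 0 ≤ v x ∧ u x * v x = 0) :
    ∃ u' ∈ nonnegSupportedOn μ A, ∃ v' ∈ nonnegSupportedOn μ Aᶜ,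
      controlToRhs hA hB (u', v') = controlToRhs hA hB (u, v) ∧
      α₁ * ‖u'‖ ^ 2 + α₂ * ‖v'‖ ^ 2 ≤ α₁ * ‖u‖ ^ 2 + α₂ * ‖v‖ ^ 2 := by
  -- On A the part of v that acts there is transferred to u; off A, where u has no effect, only v is
  -- kept.
  let u' := mulL (memLp_top_indicator_one hA) (u + mulL (memLp_top_indicator_one hB) v)
  let v' := mulL (memLp_top_indicator_one hA.compl) v
  have hux : u' =ᵐ[μ] A.indicator fun x => u x + B.indicator (fun x => v x) x := by
    filter_upwards [coeFn_mulL_indicator hA (u + mulL (memLp_top_indicator_one hB) v),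
      Lp.coeFn_add u (mulL (memLp_top_indicator_one hB) v), coeFn_mulL_indicator hB v]
      with x h1 h2 h3
    rw [h1]
    by_cases hx : x ∈ A
    · rw [Set.indicator_of_mem hx, Set.indicator_of_mem hx, h2, Pi.add_apply, h3]
    · rw [Set.indicator_of_notMem hx, Set.indicator_of_notMem hx]
  have hvx : v' =ᵐ[μ] Aᶜ.indicator fun x => v x := coeFn_mulL_indicator hA.compl v
  refine ⟨u', ?_, v', ?_, ?_, ?_⟩
  · filter_upwards [hux, h] with x h1 ⟨hu0, hv0, _⟩
    rw [h1]
    by_cases hx : x ∈ A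
    · by_cases hx' : x ∈ B <;> simp [hx, hx', hu0, add_nonneg hu0 hv0]
    · simp [hx]
  · filter_upwards [hvx, h] with x h1 ⟨hu0, hv0, _⟩
    rw [h1]
    by_cases hx : x ∈ A <;> simp [hx, hv0]
  · refine Lp.ext ?_
    filter_upwards [coeFn_controlToRhs hA hB u' v', coeFn_controlToRhs hA hB u v, hux, hvx, hAB]
      with x h1 h2 h3 h4 hx
    rw [h1, h2]
    by_cases hxA : x ∈ A
    · by_cases hxB : x ∈ B <;> simp [hxA, hxB, h3, h4]
    · have hxB : x ∈ B := hx.resolve_left hxA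
      simp [hxA, hxB, h4]
  · simp only [norm_sq_eq_integral, ← integral_const_mul]
    rw [← integral_add ((integrable_sq u').const_mul _) ((integrable_sq v').const_mul _),
      ← integral_add ((integrable_sq u).const_mul _) ((integrable_sq v).const_mul _)]
    refine integral_mono_ae
      (((integrable_sq u').const_mul _).add ((integrable_sq v').const_mul _))
      (((integrable_sq u).const_mul _).add ((integrable_sq v).const_mul _)) ?_
    filter_upwards [hux, hvx, h] with x h3 h4 ⟨hu0, hv0, huv⟩
    simp only [h3, h4]
    by_cases hxA : x ∈ A
    · by_cases hxB : x ∈ B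
      · simp only [hxA, hxB, Set.indicator_of_mem, Set.mem_compl_iff, not_true_eq_false,
          not_false_eq_true, Set.indicator_of_notMem]
        -- On A ∩ B, uv = 0 gives (u + v)² = u² + v², and α₁v² ≤ α₂v².
        nlinarith [mul_nonneg (sub_nonneg.2 hα) (sq_nonneg (v x))]
      · simp only [hxA, hxB, Set.indicator_of_mem, Set.mem_compl_iff, not_true_eq_false,
          not_false_eq_true, Set.indicator_of_notMem]
        nlinarith [mul_nonneg (hα₁.le.trans hα) (sq_nonneg (v x))]
    · simp only [hxA, Set.indicator_of_mem, Set.mem_compl_iff,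
          not_false_eq_true, Set.indicator_of_notMem]
      nlinarith [mul_nonneg hα₁.le (sq_nonneg (u x))]

end Controls

/-! ### Existence of an optimal solution by projection -/

/-- The nearest point of a closed convex set in a Hilbert space. -/
theorem exists_forall_norm_sub_le {H : Type*} [NormedAddCommGroup H] [InnerProductSpace ℝ H]
    [CompleteSpace H] {K : Set H} (hne : K.Nonempty) (hcl : IsClosed K) (hconv : Convex ℝ K)
    (p : H) : ∃ z ∈ K, ∀ z' ∈ K, ‖z - p‖ ≤ ‖z' - p‖ := by
  obtain ⟨z, hz, h⟩ := exists_norm_eq_iInf_of_complete_convex hne hcl.isComplete hconv p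
  refine ⟨z, hz, fun z' hz' => ?_⟩
  rw [norm_sub_rev z, norm_sub_rev z', h]
  exact ciInf_le ⟨0, by rintro _ ⟨w, rfl⟩; exact norm_nonneg _⟩ (⟨z', hz'⟩ : K)

section Minimization

variable {Ω : Set (E d)} {C : E d → Matrix (Fin d) (Fin d) ℝ} {a q : E d → ℝ}

/-- This symmetry reduces the general case to α₁ ≤ α₂. -/
theorem swap_mem_feasibleSet_iff {Ωu Ωv : Set (E d)} {y : H1 Ω} {u v : L2 Ω} :
    (y, v, u) ∈ feasibleSet Ω C a q Ωv Ωu ↔ (y, u, v) ∈ feasibleSet Ω C a q Ωu Ωv := by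
  simp only [feasibleSet, complementaritySet, Set.mem_ofPred_eq]
  refine and_congr (by simp only [add_comm]) (eventually_congr (Eventually.of_forall fun x => ?_))
  rw [mul_comm (v x)]
  tauto

/-- The control problem has an optimal solution if the first control is not the more expensive one. -/
theorem exists_isMinOn_of_le (hΩ : IsBoundedLipschitzDomain Ω)
    (hC : ∀ i j, MemLp (fun x => C x i j) ∞ (volume.restrict Ω)) {c₀ : ℝ} (hc₀ : 0 < c₀)
    (hell : ∀ᵐ x ∂(volume.restrict Ω), ∀ ξ : Fin d → ℝ, c₀ * (ξ ⬝ᵥ ξ) ≤ ξ ⬝ᵥ (C x *ᵥ ξ))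
    (ha : MemLp a ∞ (volume.restrict Ω)) (ha0 : ∀ᵐ x ∂(volume.restrict Ω), 0 ≤ a x)
    (hq : MemLp q ∞ (surfaceMeasure Ω)) (hq0 : ∀ᵐ x ∂(surfaceMeasure Ω), 0 ≤ q x)
    {Ωu Ωv : Set (E d)} (hΩu : NullMeasurableSet Ωu volume) (hΩv : NullMeasurableSet Ωv volume)
    (hΩuv : Ωu ∪ Ωv = Ω) (yd : L2 Ω) {α₁ α₂ : ℝ} (hα₁ : 0 < α₁) (hα : α₁ ≤ α₂) :
    ∃ p ∈ feasibleSet Ω C a q Ωu Ωv,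
      IsMinOn (objective yd α₁ α₂) (feasibleSet Ω C a q Ωu Ωv) p := by
  have hα₂ : 0 < α₂ := hα₁.trans_le hα
  have hA : NullMeasurableSet Ωu (volume.restrict Ω) :=
    hΩu.mono_ac Measure.absolutelyContinuous_restrict
  have hB : NullMeasurableSet Ωv (volume.restrict Ω) :=
    hΩv.mono_ac Measure.absolutelyContinuous_restrict
  have hAB : ∀ᵐ x ∂(volume.restrict Ω), x ∈ Ωu ∪ Ωv := by
    rw [hΩuv]
    exact ae_restrict_mem hΩ.isOpen.measurableSet
  let R := controlToRhs hA hB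
  -- The coordinates are (y, √α₁u, √α₂v), in which the objective is half a squared distance; `J`
  -- undoes the scaling and returns the state and its right-hand side.
  let J : (PiLp 2 fun _ : Fin 3 => L2 Ω) →L[ℝ] L2 Ω × L2 Ω :=
    (PiLp.proj (𝕜 := ℝ) 2 (fun _ : Fin 3 => L2 Ω) 0).prod
    (R.comp (((√α₁)⁻¹ • PiLp.proj (𝕜 := ℝ) 2 (fun _ : Fin 3 => L2 Ω) 1).prod
      ((√α₂)⁻¹ • PiLp.proj (𝕜 := ℝ) 2 (fun _ : Fin 3 => L2 Ω) 2)))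
  let K : Set (PiLp 2 fun _ : Fin 3 => L2 Ω) := J ⁻¹' (solutionSpace hC ha hq) ∩
    (PiLp.proj (𝕜 := ℝ) 2 (fun _ : Fin 3 => L2 Ω) 1 ⁻¹' nonnegSupportedOn _ Ωu ∩
      PiLp.proj (𝕜 := ℝ) 2 (fun _ : Fin 3 => L2 Ω) 2 ⁻¹' nonnegSupportedOn _ Ωuᶜ)
  have hKne : K.Nonempty := ⟨0, by
    rw [Set.mem_preimage, map_zero]; exact zero_mem _,
    zero_mem_nonnegSupportedOn _, zero_mem_nonnegSupportedOn _⟩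
  have hKcl : IsClosed K :=
    ((isClosed_solutionSpace hΩ hc₀ hell ha0 hq0).preimage J.continuous).inter
      (((isClosed_nonnegSupportedOn _).preimage (ContinuousLinearMap.continuous _)).inter
        ((isClosed_nonnegSupportedOn _).preimage (ContinuousLinearMap.continuous _)))
  have hKconv : Convex ℝ K :=
    ((solutionSpace hC ha hq).convex.linear_preimage J.toLinearMap).inter
      (((convex_nonnegSupportedOn _).linear_preimage (ContinuousLinearMap.toLinearMap _)).inter
        ((convex_nonnegSupportedOn _).linear_preimage (ContinuousLinearMap.toLinearMap _)))
  obtain ⟨z, ⟨hz₀, hz₁, hz₂⟩, hmin⟩ :=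
    exists_forall_norm_sub_le hKne hKcl hKconv (WithLp.toLp 2 ![yd, 0, 0])
  have hnorm : ∀ z : PiLp 2 fun _ : Fin 3 => L2 Ω, ‖z - WithLp.toLp 2 ![yd, 0, 0]‖ ^ 2 =
      ‖z 0 - yd‖ ^ 2 + ‖z 1‖ ^ 2 + ‖z 2‖ ^ 2 := by
    intro z
    rw [PiLp.norm_sq_eq_of_L2, Fin.sum_univ_three]
    change ‖z 0 - yd‖ ^ 2 + ‖z 1 - 0‖ ^ 2 + ‖z 2 - 0‖ ^ 2 = _
    simp only [sub_zero]
  -- The objective depends on the state only through its L² part, so any H¹ function with this part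
  -- serves.
  obtain ⟨y, hy, hsol⟩ := hz₀
  have hobj : ∀ (y : H1 Ω) (u v : L2 Ω), objective yd α₁ α₂ (y, u, v) =
      1 / 2 * (‖y.fn - yd‖ ^ 2 + (α₁ * ‖u‖ ^ 2 + α₂ * ‖v‖ ^ 2)) := fun y u v => by
    simp only [objective]; ring
  have hscale : ∀ {α : ℝ}, 0 < α → ∀ u : L2 Ω, α * ‖(√α)⁻¹ • u‖ ^ 2 = ‖u‖ ^ 2 := by
    intro α hα u
    rw [norm_smul, mul_pow, Real.norm_eq_abs, sq_abs, inv_pow, Real.sq_sqrt hα.le, ← mul_assoc,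
      mul_inv_cancel₀ hα.ne', one_mul]
  have hscale' : ∀ {α : ℝ}, 0 < α → ∀ u : L2 Ω, ‖√α • u‖ ^ 2 = α * ‖u‖ ^ 2 := by
    intro α hα u
    rw [norm_smul, mul_pow, Real.norm_eq_abs, sq_abs, Real.sq_sqrt hα.le]
  refine ⟨(y, (√α₁)⁻¹ • z 1, (√α₂)⁻¹ • z 2), ⟨?_, ?_⟩, ?_⟩
  · exact (isWeakSolution_iff hC ha hq (coeFn_controlToRhs hA hB _ _) y).2 hsol
  · have h1 := smul_mem_nonnegSupportedOn hz₁ (inv_nonneg.2 (Real.sqrt_nonneg α₁))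
    have h2 := smul_mem_nonnegSupportedOn hz₂ (inv_nonneg.2 (Real.sqrt_nonneg α₂))
    change ∀ᵐ x ∂(volume.restrict Ω), _
    filter_upwards [h1, h2] with x hx1 hx2
    refine ⟨hx1.1, hx2.1, ?_⟩
    -- Complementarity follows from the disjointness of the prescribed supports.
    by_cases hx : x ∈ Ωu
    · exact mul_eq_zero_of_right _ (hx2.2 fun h => h hx)
    · exact mul_eq_zero_of_left (hx1.2 hx) _
  · rintro ⟨y', u, v⟩ ⟨hw, hcompl⟩
    obtain ⟨u', hu', v', hv', hR, hcost⟩ :=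
      exists_nonnegSupportedOn_of_complementary hA hB hAB hα₁ hα hcompl
    have hw' := (isWeakSolution_iff hC ha hq (coeFn_controlToRhs hA hB u v) y').1 hw
    rw [← hR] at hw'
    -- The competitor's own state is retained, since the modified controls produce the same
    -- right-hand side.
    have hmem : (WithLp.toLp 2 ![y'.fn, √α₁ • u', √α₂ • v']) ∈ K := by
      refine ⟨⟨y', rfl, ?_⟩, smul_mem_nonnegSupportedOn hu' (Real.sqrt_nonneg _),
        smul_mem_nonnegSupportedOn hv' (Real.sqrt_nonneg _)⟩
      have hJ : (J (WithLp.toLp 2 ![y'.fn, √α₁ • u', √α₂ • v'])).2 = R (u', v') := by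
        change R ((√α₁)⁻¹ • √α₁ • u', (√α₂)⁻¹ • √α₂ • v') = _
        rw [inv_smul_smul₀ (Real.sqrt_pos.2 hα₁).ne', inv_smul_smul₀ (Real.sqrt_pos.2 hα₂).ne']
      rw [hJ]
      exact hw'
    have hle := pow_le_pow_left₀ (norm_nonneg _) (hmin _ hmem) 2
    rw [hnorm, hnorm] at hle
    simp only [Matrix.cons_val_zero, Matrix.cons_val_one, Matrix.cons_val, hscale' hα₁,
      hscale' hα₂] at hle
    change objective yd α₁ α₂ _ ≤ objective yd α₁ α₂ _
    rw [hobj, hobj, hscale hα₁, hscale hα₂, hy]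
    change 1 / 2 * (‖z 0 - yd‖ ^ 2 + _) ≤ _
    linarith

end Minimization

/-! ### Square waves and failure of weak closedness -/

/-- The square wave of period two with values `±1`. -/
noncomputable def squareWave (t : ℝ) : ℝ := if Even ⌊t⌋ then 1 else -1

theorem squareWave_add_one (t : ℝ) : squareWave (t + 1) = -squareWave t := by
  simp only [squareWave, Int.floor_add_one, Int.even_add_one]
  by_cases h : Even ⌊t⌋ <;> simp [h]

theorem abs_squareWave (t : ℝ) : |squareWave t| = 1 := by
  unfold squareWave
  split_ifs <;> simp

theorem squareWave_mul_self (t : ℝ) : squareWave t * squareWave t = 1 := by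
  rw [← abs_mul_abs_self, abs_squareWave, one_mul]

theorem measurable_squareWave : Measurable squareWave :=
  Measurable.ite (Int.measurable_floor (MeasurableSet.of_discrete (s := {n : ℤ | Even n})))
    measurable_const measurable_const

/-- The square wave of frequency `n` in direction `i`. -/
noncomputable def wave (i : Fin d) (n : ℕ) (x : E d) : ℝ := squareWave (((n : ℝ) + 1) * x i)

theorem measurable_wave (i : Fin d) (n : ℕ) : Measurable (wave i n) :=
  measurable_squareWave.comp (Continuous.measurable (by fun_prop))

theorem wave_add (i : Fin d) (n : ℕ) (x : E d) :
    wave i n (((n : ℝ) + 1)⁻¹ • unitVec i + x) = -wave i n x := by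
  rw [wave, wave, ← squareWave_add_one]
  congr 1
  have : (n : ℝ) + 1 ≠ 0 := by positivity
  simp
  field_simp
  ring

/-- Square waves of increasing frequency tend weakly to zero. -/
theorem tendsto_integral_mul_wave {f : E d → ℝ} (hf : Integrable f) (i : Fin d) :
    Tendsto (fun n => ∫ x, f x * wave i n x) atTop (𝓝 0) := by
  have hfl := memLp_one_iff_integrable.2 hf
  let F : Lp ℝ 1 (volume : Measure (E d)) := hfl.toLp
  let v : ℕ → E d := fun n => ((n : ℝ) + 1)⁻¹ • unitVec i
  let S : ℕ → Lp ℝ 1 (volume : Measure (E d)) := fun n => DomAddAct.mk (v n) +ᵥ F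
  have hv : Tendsto v atTop (𝓝 0) := by
    have h := (tendsto_inv_atTop_zero.comp (tendsto_natCast_atTop_atTop (R := ℝ) |>.atTop_add
      (tendsto_const_nhds (x := (1 : ℝ))))).smul_const (unitVec i : E d)
    simpa using h
  have hfact : Fact ((1 : ℝ≥0∞) ≠ ⊤) := ⟨ENNReal.one_ne_top⟩
  have hlim : Tendsto (fun n => ‖F - S n‖) atTop (𝓝 0) := by
    have h1 : Tendsto S atTop (𝓝 (DomAddAct.mk (0 : E d) +ᵥ F)) :=
      ((DomAddAct.continuous_mk.tendsto 0).comp hv).vadd tendsto_const_nhds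
    rw [DomAddAct.mk_zero, zero_vadd] at h1
    simpa using (h1.const_sub F).norm
  -- `v n` is half a period, so translation by it flips the sign of the wave. Hence 2∫ f rₙ = ∫ (f -
  -- f(v n + ·)) rₙ, which is bounded by an L¹ norm that vanishes by continuity of translations.
  have hbound : ∀ n, ‖∫ x, f x * wave i n x‖ ≤ ‖F - S n‖ := by
    intro n
    have hb : ∀ x, ‖wave i n x‖ ≤ 1 := fun x => (abs_squareWave _).le
    have hm := (measurable_wave i n).aestronglyMeasurable (μ := (volume : Measure (E d)))
    have hint : ∀ {g : E d → ℝ}, Integrable g → Integrable fun x => g x * wave i n x :=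
      fun hg => hg.mul_bdd hm (Eventually.of_forall hb)
    have hfv : Integrable fun x => f (v n + x) := hf.comp_add_left (v n)
    have hshift : ∫ x, f (v n + x) * wave i n x = -∫ x, f x * wave i n x := by
      rw [← integral_add_left_eq_self (fun x => f x * wave i n x) (v n), ← integral_neg]
      simp only [v, wave_add, mul_neg, neg_neg]
    have hae : ∀ᵐ x, (F - S n) x = f x - f (v n + x) := by
      have h1 := DomAddAct.vadd_Lp_ae_eq (DomAddAct.mk (v n)) F
      have h2 := (measurePreserving_add_left (volume : Measure (E d)) (v n)).quasiMeasurePreserving.ae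
        hfl.coeFn_toLp
      filter_upwards [Lp.coeFn_sub F (S n), hfl.coeFn_toLp, h1, h2] with x e1 e2 e3 e4
      rw [e1, Pi.sub_apply, e2]
      congr 1
      exact e3.trans e4
    have htwo : 2 * ∫ x, f x * wave i n x = ∫ x, (F - S n) x * wave i n x := by
      have e : ∫ x, (F - S n) x * wave i n x =
          ∫ x, (f x * wave i n x - f (v n + x) * wave i n x) := by
        refine integral_congr_ae ?_
        filter_upwards [hae] with x hx
        rw [hx, sub_mul]
      rw [e, integral_sub (hint hf) (hint hfv), hshift]
      ring
    have hle : ‖∫ x, (F - S n) x * wave i n x‖ ≤ ‖F - S n‖ := by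
      rw [L1.norm_eq_integral_norm]
      refine norm_integral_le_of_norm_le (L1.integrable_coeFn _).norm
        (Eventually.of_forall fun x => ?_)
      rw [norm_mul]
      exact mul_le_of_le_one_right (norm_nonneg _) (hb x)
    rw [← htwo, norm_mul, Real.norm_ofNat] at hle
    linarith [norm_nonneg (∫ x, f x * wave i n x)]
  exact squeeze_zero_norm hbound hlim

/-- The criterion for weak convergence needs the dual to separate points, which is Hahn–Banach. -/
theorem tendsto_toWeakSpace {V : Type*} [NormedAddCommGroup V] [NormedSpace ℝ V] {u : ℕ → V}
    {v : V} (h : ∀ ℓ : V →L[ℝ] ℝ, Tendsto (fun n => ℓ (u n)) atTop (𝓝 (ℓ v))) :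
    Tendsto (fun n => toWeakSpace ℝ V (u n)) atTop (𝓝 (toWeakSpace ℝ V v)) := by
  refine (WeakBilin.tendsto_iff_forall_eval_tendsto (topDualPairing ℝ V).flip ?_).2 h
  intro x y hxy
  by_contra hne
  obtain ⟨ℓ, hℓ⟩ := SeparatingDual.exists_separating_of_ne (R := ℝ) hne
  exact hℓ (LinearMap.congr_fun hxy ℓ)

/-- The complementarity set is not weakly sequentially closed: the pairs `((1 ± r)/2)` with fast
square waves `r` tend weakly to `(1/2, 1/2)`. -/
theorem not_isSeqClosed_complementaritySet (hd : 0 < d) {Ω : Set (E d)}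
    (hΩ : IsBoundedLipschitzDomain Ω) :
    ¬ IsSeqClosed (toWeakSpace ℝ (L2 Ω × L2 Ω) '' complementaritySet Ω) := by
  intro hclosed
  have hfin : IsFiniteMeasure (volume.restrict Ω) :=
    isFiniteMeasure_restrict.2 hΩ.isBounded.measure_lt_top.ne
  let i : Fin d := ⟨0, hd⟩
  have hr : ∀ n, MemLp (wave i n) 2 (volume.restrict Ω) := fun n =>
    MemLp.of_bound (measurable_wave i n).aestronglyMeasurable 1
      (Eventually.of_forall fun x => (abs_squareWave _).le)
  have hh : MemLp (fun _ : E d => (1 / 2 : ℝ)) 2 (volume.restrict Ω) := memLp_const _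
  let ρ : ℕ → L2 Ω := fun n => (hr n).toLp
  let half : L2 Ω := hh.toLp
  have hρ : ∀ n, ∀ᵐ x ∂(volume.restrict Ω), ρ n x = wave i n x := fun n => (hr n).coeFn_toLp
  have hhalf : ∀ᵐ x ∂(volume.restrict Ω), half x = 1 / 2 := hh.coeFn_toLp
  let p : ℕ → L2 Ω × L2 Ω := fun n =>
    (half + (1 / 2 : ℝ) • ρ n, half - (1 / 2 : ℝ) • ρ n)
  have hp : ∀ n, p n ∈ complementaritySet Ω := by
    intro n
    change ∀ᵐ x ∂(volume.restrict Ω), _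
    filter_upwards [hρ n, hhalf, Lp.coeFn_add half ((1 / 2 : ℝ) • ρ n),
      Lp.coeFn_sub half ((1 / 2 : ℝ) • ρ n), Lp.coeFn_smul (1 / 2 : ℝ) (ρ n)] with x h1 h2 h3 h4 h5
    have e1 : (p n).1 x = 1 / 2 + 1 / 2 * wave i n x := by
      rw [h3, Pi.add_apply, h5, Pi.smul_apply, h1, h2, smul_eq_mul]
    have e2 : (p n).2 x = 1 / 2 - 1 / 2 * wave i n x := by
      rw [h4, Pi.sub_apply, h5, Pi.smul_apply, h1, h2, smul_eq_mul]
    have habs := abs_le.1 (abs_squareWave (((n : ℝ) + 1) * x i)).le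
    have hsq := squareWave_mul_self (((n : ℝ) + 1) * x i)
    rw [e1, e2, wave]
    refine ⟨by linarith, by linarith, ?_⟩
    -- The product of the two controls is (1 - r²)/4, and r² = 1.
    linear_combination (-1 / 4) * hsq
  have hlim : Tendsto (fun n => toWeakSpace ℝ (L2 Ω × L2 Ω) (p n)) atTop
      (𝓝 (toWeakSpace ℝ (L2 Ω × L2 Ω) (half, half))) := by
    refine tendsto_toWeakSpace fun ℓ => ?_
    -- Only the oscillating part (ρ, -ρ) matters. Its functional has a Riesz representative in
    -- L²(Ω), which is integrable since Ω has finite measure and is then extended by zero.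
    let m : L2 Ω →L[ℝ] ℝ := ℓ.comp ((ContinuousLinearMap.id ℝ (L2 Ω)).prod
      (-ContinuousLinearMap.id ℝ (L2 Ω)))
    let w : L2 Ω := (InnerProductSpace.toDual ℝ (L2 Ω)).symm m
    have hw : ∀ u, m u = inner ℝ w u := fun u =>
      (InnerProductSpace.toDual_symm_apply (𝕜 := ℝ) (x := u) (y := m)).symm
    have hwi : Integrable (Ω.indicator fun x => w x) volume :=
      (integrable_indicator_iff hΩ.isOpen.measurableSet).2
        ((Lp.memLp w).integrable (by norm_num))
    have hmρ : ∀ n, m (ρ n) = ∫ x, Ω.indicator (fun x => w x) x * wave i n x := by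
      intro n
      rw [hw, L2.inner_def]
      have e : (fun x => Ω.indicator (fun x => w x) x * wave i n x) =
          Ω.indicator fun x => w x * wave i n x := by
        ext x
        by_cases hx : x ∈ Ω <;> simp [hx]
      rw [e, integral_indicator hΩ.isOpen.measurableSet]
      refine integral_congr_ae ?_
      filter_upwards [hρ n] with x hx
      simp [hx, mul_comm]
    have hsplit : ∀ n, ℓ (p n) = ℓ (half, half) + 1 / 2 * m (ρ n) := by
      intro n
      have e : p n = (half, half) + (1 / 2 : ℝ) • (ρ n, -ρ n) := by
        simp [p, sub_eq_add_neg]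
      rw [e, map_add, map_smul, smul_eq_mul]
      rfl
    simp only [hsplit, hmρ]
    have h := ((tendsto_integral_mul_wave hwi i).const_mul (1 / 2)).const_add (ℓ (half, half))
    rwa [mul_zero, add_zero] at h
  obtain ⟨p', hp', heq⟩ := hclosed (fun n => Set.mem_image_of_mem _ (hp n)) hlim
  rw [(toWeakSpace ℝ (L2 Ω × L2 Ω)).injective heq] at hp'
  -- The limit controls have product 1/4, so complementarity would force Ω to be a null set.
  have hfalse : ∀ᵐ x ∂(volume.restrict Ω), False := by
    filter_upwards [hp', hhalf] with x h1 h2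
    have := h1.2.2
    simp only [h2] at this
    norm_num at this
  rw [eventually_false_iff_eq_bot, ae_eq_bot, Measure.restrict_eq_zero] at hfalse
  exact (hΩ.isOpen.measure_pos volume hΩ.isConnected.nonempty).ne' hfalse

end RobinControl

theorem proposition2p5 {d : ℕ} (hd : 0 < d) (Ω : Set (RobinControl.E d))
    (hΩ : RobinControl.IsBoundedLipschitzDomain Ω)
    (C : RobinControl.E d → Matrix (Fin d) (Fin d) ℝ)
    (hC : ∀ i j, MemLp (fun x => C x i j) ∞ (volume.restrict Ω))
    (hC_symm : ∀ᵐ x ∂(volume.restrict Ω), (C x).IsSymm)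
    (hC_elliptic : ∃ c₀ : ℝ, 0 < c₀ ∧ ∀ᵐ x ∂(volume.restrict Ω), ∀ ξ : Fin d → ℝ,
      c₀ * (ξ ⬝ᵥ ξ) ≤ ξ ⬝ᵥ (C x *ᵥ ξ))
    (a : RobinControl.E d → ℝ) (ha : MemLp a ∞ (volume.restrict Ω))
    (ha_nonneg : ∀ᵐ x ∂(volume.restrict Ω), 0 ≤ a x)
    (q : RobinControl.E d → ℝ) (hq : MemLp q ∞ (RobinControl.surfaceMeasure Ω))
    (hq_nonneg : ∀ᵐ x ∂(RobinControl.surfaceMeasure Ω), 0 ≤ q x)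
    (haq : 0 < eLpNorm a ∞ (volume.restrict Ω) + eLpNorm q ∞ (RobinControl.surfaceMeasure Ω))
    (Ωu Ωv : Set (RobinControl.E d))
    (hΩu : NullMeasurableSet Ωu volume) (hΩv : NullMeasurableSet Ωv volume)
    (hΩu_pos : 0 < volume Ωu) (hΩv_pos : 0 < volume Ωv) (hΩuv : Ωu ∪ Ωv = Ω)
    (yd : RobinControl.L2 Ω) (α₁ α₂ : ℝ) (hα₁ : 0 < α₁) (hα₂ : 0 < α₂) :
    (∃ p ∈ RobinControl.feasibleSet Ω C a q Ωu Ωv,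
      IsMinOn (RobinControl.objective yd α₁ α₂) (RobinControl.feasibleSet Ω C a q Ωu Ωv) p) ∧
    ¬ IsSeqClosed (toWeakSpace ℝ (RobinControl.L2 Ω × RobinControl.L2 Ω) ''
        RobinControl.complementaritySet Ω) := by
  obtain ⟨c₀, hc₀, hell⟩ := hC_elliptic
  refine ⟨?_, RobinControl.not_isSeqClosed_complementaritySet hd hΩ⟩
  rcases le_total α₁ α₂ with hα | hα
  · exact RobinControl.exists_isMinOn_of_le hΩ hC hc₀ hell ha ha_nonneg hq hq_nonneg hΩu hΩv hΩuv yd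
      hα₁ hα
  · obtain ⟨⟨y, v, u⟩, hp, hmin⟩ := RobinControl.exists_isMinOn_of_le hΩ hC hc₀ hell ha ha_nonneg
      hq hq_nonneg hΩv hΩu ((Set.union_comm _ _).trans hΩuv) yd hα₂ hα
    refine ⟨(y, u, v), RobinControl.swap_mem_feasibleSet_iff.1 hp, ?_⟩
    rintro ⟨y', u', v'⟩ hp'
    have h := hmin (RobinControl.swap_mem_feasibleSet_iff.2 hp')
    simp only [Set.mem_ofPred_eq, RobinControl.objective] at h ⊢
    linarith
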